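/- **Setting.** Everything takes place in the topos of sheaves on a site $(C,J)$, read in its internal (intuitionistic) logic; "space" means sheaf, "point" means generalised element, and existence is local existence on a cover unless the object is unique. Let $R$ be a commutative $\mathbb{Q}$-algebra in this topos. Put $D(n)=\{d\in R^n: d_id_j=0\}$ and $D_2(n)=\{d\in R^n: d_id_jd_k=0\}$ (all indices), $D=D(1)$, and assume the Kock–Lawvere axioms: for every $n\ge 1$ each map $D(n)\to R$ is of the form $d\mapsto a_0+\sum_j a_jd_j$ for unique $a_0,\dots,a_n\in R$, and each map $D_2(n)\to R$ is given by a unique polynomial of total degree $\le 2$ with coefficients in $R$. Let $V=R^n$. A subspace $U\subseteq X$ is *formally open* if every map $D(m)\to X$ or $D_2(m)\to X$ ($m\ge1$) sending $0$ into $U$ factors through $U$. A *formal manifold* $M$ modelled on $V$ is a space covered by *charts*, i.e. formally open subspaces $U\subseteq M$ equipped with an embedding onto a formally open subspace of $V$; we identify points of $U$ with their coordinates in $V$. *Infinitesimal structures.* An *i-structure* on a space $A$ is a family of subspaces $A\langle m\rangle\subseteq A^m$, $m\ge0$, closed under reindexing along all maps of finite sets, with $A\langle0\rangle=1$ and $A\langle1\rangle=A$;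 write $\langle P_1,\dots,P_m\rangle$ for membership. Write $M\langle2\rangle$ for the first-order neighbour relation on $M$, given in charts by $Q-P\in D(n)$. The second-order i-structure $M_2$ is given in charts by: $\langle P_1,\dots,P_m\rangle\in M_2\langle m\rangle$ iff for all indices $\phi[P_{i_1}-P_{j_1},P_{i_2}-P_{j_2},P_{i_3}-P_{j_3}]=0$ for every trilinear $\phi:V^3\to R$. (Both are the joint image over all charts.) For $P\in M$ let $\mathfrak M(P)=\{Q:\langle P,Q\rangle\in M\langle2\rangle\}$ and $\mathfrak M_2(P)=\{Q:\langle P,Q\rangle\in M_2\langle2\rangle\}$; the latter carries the i-structure $\langle Q_1,\dots,Q_m\rangle\in\mathfrak M_2(P)\langle m\rangle$ iff $\langle P,Q_1,\dots,Q_m\rangle\in M_2\langle m+1\rangle$. An *infinitesimal group (i-group)* is a space $G$ with an i-structure, a product $G\langle2\rangle\to G$, an inversion $G\to G$ and a constant $e\in G$ such that $\langle P,Q,P_1,\dots,P_m\rangle$ implies $\langle PQ,P_1,\dots,P_m\rangle$; $\langle P,P_1,\dots,P_m\rangle$ implies $\langle P^{-1},P_1,\dots,P_m\rangle$; $\langle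 P_1,\dots,P_m\rangle$ implies $\langle e,P_1,\dots,P_m\rangle$ (for all $m\ge0$); $(PQ)S=P(QS)$ for $\langle P,Q,S\rangle\in G\langle3\rangle$; and $eP=Pe=P$, $PP^{-1}=P^{-1}P=e$ for all $P\in G$. An *affine connection* on $M$ is a map $\lambda$ assigning to every triple $(P,Q,S)$ with $\langle P,Q\rangle,\langle P,S\rangle\in M\langle2\rangle$ a point $\lambda(P,Q,S)\in M$ with $\lambda(P,Q,P)=Q$ and $\lambda(P,P,S)=S$; it need not be symmetric in $Q,S$. Its torsion is $\tau_P(Q,S)=\lambda(\lambda(P,Q,S),Q,S)$. **Theorem.** Let $M$ be a formal manifold and $\lambda$ an arbitrary affine connection on $M$. Then $\lambda$ induces, naturally in $P\in M$, an i-group structure on $\mathfrak M_2(P)$ with neutral element $P$, such that for all $Q,S\in\mathfrak M(P)$ one has $\langle Q,S\rangle\in\mathfrak M_2(P)\langle2\rangle$ and $$QS=\lambda(P,Q,S).$$ More precisely, in every chart containing $P$ the following holds. (a) There is a bilinear map $\Gamma_P:V\times V\to V$, the connection symbol, such that for all $Q,S\in\mathfrak M(P)$ the points $Q$, $S$ and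 $\lambda(P,Q,S)$ lie in the chart and $\lambda(P,Q,S)=Q+S-P+\Gamma_P[Q-P,S-P]$. (b) There is a bilinear bracket $[-,-]_P$ on the tangent space $T_PM\cong V$ given by minus the torsion: for all tangent vectors $t_1,t_2$ at $P$, with $t_i(d)=P+d\,v_i$, and all $d_1,d_2\in D$, the torsion $\tau_P(t_1(d_1),t_2(d_2))$ is defined, lies in the chart, and $$P+d_1d_2\,[v_1,v_2]_P=P-\bigl(\tau_P(t_1(d_1),t_2(d_2))-P\bigr).$$ (c) Let $\bar\Gamma_P[v,w]=\tfrac12(\Gamma_P[v,w]+\Gamma_P[w,v])$ be the symbol of the symmetrised connection, and let $$\log_P(Q)=(Q-P)-\tfrac12\bar\Gamma_P[Q-P,Q-P],\qquad \exp_P(v)=P+v+\tfrac12\bar\Gamma_P[v,v]$$ be its second-order logarithm and exponential. Then $\mathfrak M_2(P)$ is contained in the chart, and $$QS=\exp_P\Bigl(\log_P Q+\log_P S+\tfrac12\bigl[\log_P Q,\log_P S\bigr]_P\Bigr),\qquad Q^{-1}=\exp_P(-\log_P Q)$$ for all $\langle Q,S\rangle\in\mathfrak M_2(P)\langle2\rangle$,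 respectively all $Q\in\mathfrak M_2(P)$. -/

import Mathlib

open CategoryTheory Opposite

universe w v u

/-!
Synthetic differential geometry is carried out inside a Grothendieck topos `Sh(C, J)`.  A space is a
sheaf on the site `(C, J)`, an element `P ∈ M` is a generalised element `P ∈ M(c)` at a stage
`c : C`, and the statements of the theory (whose logic is intuitionistic) are spelled out by the
sheaf semantics: universal quantifiers range over all later stages `c' ⟶ c`, and existence means
existence on a covering sieve, unless uniqueness makes it global.
-/

namespace SDG

variable {C : Type u} [Category.{v} C]

/-- Restriction of a generalised element `x ∈ X(c)` to a later stage `f : c' ⟶ c`. -/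
def rst (X : Cᵒᵖ ⥤ Type w) {c c' : C} (f : c' ⟶ c) (x : X.obj (op c)) : X.obj (op c') :=
  X.map f.op x

/-! ### The line `R`, the spaces `Rⁿ`, `D(n)`, `D₂(n)` and the Kock-Lawvere axioms -/

section Line

variable (R : Cᵒᵖ ⥤ CommAlgCat.{w} ℚ)

/-- The `ℚ`-algebra of elements of `R` at stage `c`. -/
abbrev Scal (c : C) : Type w := R.obj (op c)

/-- Restriction of scalars to a later stage. -/
def sres {c c' : C} (f : c' ⟶ c) : Scal R c →ₐ[ℚ] Scal R c' := (R.map f.op).hom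

/-- Restriction of vectors of `Rⁿ` to a later stage. -/
def vres {n : ℕ} {c c' : C} (f : c' ⟶ c) (x : Fin n → Scal R c) : Fin n → Scal R c' :=
  fun i => sres R f (x i)

end Line

/-- `d ∈ D(n)`: all products of two coordinates vanish. -/
def InD {S : Type*} [CommRing S] {n : ℕ} (d : Fin n → S) : Prop :=
  ∀ i j, d i * d j = 0

/-- `d ∈ D₂(n)`: all products of three coordinates vanish. -/
def InD₂ {S : Type*} [CommRing S] {n : ℕ} (d : Fin n → S) : Prop :=
  ∀ i j k, d i * d j * d k = 0

section KockLawvere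

variable (R : Cᵒᵖ ⥤ CommAlgCat.{w} ℚ)

theorem InD.vres {n : ℕ} {c c' : C} (f : c' ⟶ c) {d : Fin n → Scal R c} (h : InD d) :
    InD (vres R f d) := by
  intro i j
  simp only [SDG.vres, ← map_mul, h i j, map_zero]

theorem InD₂.vres {n : ℕ} {c c' : C} (f : c' ⟶ c) {d : Fin n → Scal R c} (h : InD₂ d) :
    InD₂ (vres R f d) := by
  intro i j k
  simp only [SDG.vres, ← map_mul, h i j k, map_zero]

theorem sres_id {c : C} (x : Scal R c) : sres R (𝟙 c) x = x := by
  simp [sres]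

theorem sres_comp {c c' c'' : C} (f : c' ⟶ c) (g : c'' ⟶ c') (x : Scal R c) :
    sres R (g ≫ f) x = sres R g (sres R f x) := by
  simp [sres]

/-- The space `Rⁿ`. -/
def affineSpace (n : ℕ) : Cᵒᵖ ⥤ Type w where
  obj c := Fin n → Scal R c.unop
  map f := TypeCat.ofHom (fun x => vres R f.unop x)
  map_id c := by
    ext x i
    exact sres_id R (x i)
  map_comp f g := by
    ext x i
    exact sres_comp R f.unop g.unop (x i)

/-- The space `D(n)` of first-order infinitesimals. -/
def D (n : ℕ) : Cᵒᵖ ⥤ Type w where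
  obj c := {d : Fin n → Scal R c.unop // InD d}
  map f := TypeCat.ofHom (fun d => ⟨vres R f.unop d.1, d.2.vres R f.unop⟩)
  map_id c := by
    ext x i
    exact sres_id R (x.1 i)
  map_comp f g := by
    ext x i
    exact sres_comp R f.unop g.unop (x.1 i)

/-- The space `D₂(n)` of second-order infinitesimals. -/
def D₂ (n : ℕ) : Cᵒᵖ ⥤ Type w where
  obj c := {d : Fin n → Scal R c.unop // InD₂ d}
  map f := TypeCat.ofHom (fun d => ⟨vres R f.unop d.1, d.2.vres R f.unop⟩)
  map_id c := by
    ext x i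
    exact sres_id R (x.1 i)
  map_comp f g := by
    ext x i
    exact sres_comp R f.unop g.unop (x.1 i)

/-- The base point `0 ∈ D(n)`. -/
def D.zero (n : ℕ) (c : C) : (D R n).obj (op c) := ⟨fun _ => 0, fun _ _ => by simp⟩

/-- The base point `0 ∈ D₂(n)`. -/
def D₂.zero (n : ℕ) (c : C) : (D₂ R n).obj (op c) := ⟨fun _ => 0, fun _ _ _ => by simp⟩

end KockLawvere

/-- A map `A → X` of spaces at stage `c`, that is, an element at stage `c` of the space of maps
`X ^ A` (a morphism `y(c) × A ⟶ X`). -/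
structure StageMap (A X : Cᵒᵖ ⥤ Type w) (c : C) where
  app : ∀ {c' : C}, (c' ⟶ c) → A.obj (op c') → X.obj (op c')
  natural : ∀ {c' c'' : C} (f : c' ⟶ c) (g : c'' ⟶ c') (a : A.obj (op c')),
    rst X g (app f a) = app (g ≫ f) (rst A g a)

/-- `R` is a (sheaf of) commutative `ℚ`-algebra(s) satisfying the Kock-Lawvere axioms for the spaces
`D(n)` and `D₂(n)`, `n ≥ 1`. -/
structure IsKockLawvere (J : GrothendieckTopology C) (R : Cᵒᵖ ⥤ CommAlgCat.{w} ℚ) : Prop where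
  isSheaf : Presieve.IsSheaf J (R ⋙ forget (CommAlgCat.{w} ℚ))
  first : ∀ n : ℕ, 1 ≤ n → ∀ (c : C) (t : StageMap (D R n) (affineSpace R 1) c),
    ∃! a : Scal R c × (Fin n → Scal R c),
      ∀ {c' : C} (f : c' ⟶ c) (d : (D R n).obj (op c')),
        t.app f d 0 = sres R f a.1 + ∑ j, sres R f (a.2 j) * d.1 j
  second : ∀ n : ℕ, 1 ≤ n → ∀ (c : C) (t : StageMap (D₂ R n) (affineSpace R 1) c),
    ∃! a : Scal R c × (Fin n → Scal R c) × ({p : Fin n × Fin n // p.1 ≤ p.2} → Scal R c),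
      ∀ {c' : C} (f : c' ⟶ c) (d : (D₂ R n).obj (op c')),
        t.app f d 0 = sres R f a.1 + ∑ j, sres R f (a.2.1 j) * d.1 j +
          ∑ p, sres R f (a.2.2 p) * (d.1 p.1.1 * d.1 p.1.2)

/-! ### Formal manifolds -/

/-- A subspace, at stage `c`, of a space `X`. -/
structure StageSub (J : GrothendieckTopology C) (X : Cᵒᵖ ⥤ Type w) (c : C) where
  carrier : ∀ {c' : C}, (c' ⟶ c) → Set (X.obj (op c'))
  restrict : ∀ {c' c'' : C} (f : c' ⟶ c) (g : c'' ⟶ c') (x : X.obj (op c')),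
    x ∈ carrier f → rst X g x ∈ carrier (g ≫ f)
  isLocal : ∀ {c' : C} (f : c' ⟶ c) (x : X.obj (op c')) (S : Sieve c'), S ∈ J c' →
    (∀ {c'' : C} (g : c'' ⟶ c'), S g → rst X g x ∈ carrier (g ≫ f)) → x ∈ carrier f

/-- Formal openness of a family `U` of elements of `X` (at stage `c`): any map `D(m) → X` or
`D₂(m) → X` sending `0` into `U` factors through `U`. -/
structure FormallyOpen (R : Cᵒᵖ ⥤ CommAlgCat.{w} ℚ) (X : Cᵒᵖ ⥤ Type w) {c : C}
    (U : ∀ {c' : C}, (c' ⟶ c) → Set (X.obj (op c'))) : Prop where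
  first : ∀ m : ℕ, 1 ≤ m → ∀ {c' : C} (f : c' ⟶ c) (t : StageMap (D R m) X c'),
    t.app (𝟙 c') (D.zero R m c') ∈ U f →
      ∀ {c'' : C} (g : c'' ⟶ c') (d : (D R m).obj (op c'')), t.app g d ∈ U (g ≫ f)
  second : ∀ m : ℕ, 1 ≤ m → ∀ {c' : C} (f : c' ⟶ c) (t : StageMap (D₂ R m) X c'),
    t.app (𝟙 c') (D₂.zero R m c') ∈ U f →
      ∀ {c'' : C} (g : c'' ⟶ c') (d : (D₂ R m).obj (op c'')), t.app g d ∈ U (g ≫ f)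

/-- A chart of `M` at stage `c`: a formally open subspace `dom` of `M` together with an embedding
`coord` of `dom` onto a formally open subspace of `Rⁿ`. The values of `coord` outside of `dom` are
irrelevant. -/
structure Chart (J : GrothendieckTopology C) (R : Cᵒᵖ ⥤ CommAlgCat.{w} ℚ) (M : Cᵒᵖ ⥤ Type w)
    (n : ℕ) (c : C) where
  dom : StageSub J M c
  coord : ∀ {c' : C}, (c' ⟶ c) → M.obj (op c') → (Fin n → Scal R c')
  coord_natural : ∀ {c' c'' : C} (f : c' ⟶ c) (g : c'' ⟶ c') (x : M.obj (op c')),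
    x ∈ dom.carrier f → coord (g ≫ f) (rst M g x) = vres R g (coord f x)
  coord_injOn : ∀ {c' : C} (f : c' ⟶ c), Set.InjOn (coord f) (dom.carrier f)
  dom_open : FormallyOpen R M (fun f => dom.carrier f)
  image_open : FormallyOpen R (affineSpace R n) (fun f => coord f '' dom.carrier f)

/-- `M` is a formal manifold modelled on `Rⁿ`: a space covered by charts. -/
structure IsFormalManifold (J : GrothendieckTopology C) (R : Cᵒᵖ ⥤ CommAlgCat.{w} ℚ)
    (M : Cᵒᵖ ⥤ Type w) (n : ℕ) : Prop where
  isSheaf : Presieve.IsSheaf J M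
  cover : ∀ {c : C} (P : M.obj (op c)), ∃ S ∈ J c, ∀ {c' : C} (f : c' ⟶ c), S f →
    ∃ κ : Chart J R M n c', rst M f P ∈ κ.dom.carrier (𝟙 c')

/-! ### Infinitesimal structures -/

/-- An i-structure on a space `A`: subspaces `A⟨n⟩ ⊆ Aⁿ`, with `nbr x` meaning
`⟨x 0, …, x (n-1)⟩ ∈ A⟨n⟩`. -/
structure IStructure (J : GrothendieckTopology C) (A : Cᵒᵖ ⥤ Type w) where
  nbr : ∀ {c : C} {n : ℕ}, (Fin n → A.obj (op c)) → Prop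
  restrict : ∀ {c c' : C} (f : c' ⟶ c) {n : ℕ} (x : Fin n → A.obj (op c)),
    nbr x → nbr (fun i => rst A f (x i))
  isLocal : ∀ {c : C} {n : ℕ} (x : Fin n → A.obj (op c)) (S : Sieve c), S ∈ J c →
    (∀ {c' : C} (f : c' ⟶ c), S f → nbr (fun i => rst A f (x i))) → nbr x
  nbr_zero : ∀ {c : C} (x : Fin 0 → A.obj (op c)), nbr x
  nbr_one : ∀ {c : C} (x : Fin 1 → A.obj (op c)), nbr x
  reindex : ∀ {c : C} {m n : ℕ} (h : Fin m → Fin n) (x : Fin n → A.obj (op c)),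
    nbr x → nbr (x ∘ h)

/-- `(u, v, w) ∈ DN₂(Rⁿ)`: each vector lies in `D₂(n)`, and all trilinear forms vanish on `(u, v, w)`
(it is enough to consider the products of coordinates, which span the trilinear forms). -/
def InDN₂ {S : Type*} [CommRing S] {n : ℕ} (u v w : Fin n → S) : Prop :=
  (InD₂ u ∧ InD₂ v ∧ InD₂ w) ∧ ∀ i j k, u i * v j * w k = 0

/-- The second-order i-structure of `Rⁿ`. (For `m ≤ 1` it holds for every `m`-tuple.) -/
def Nbr₂Vec {S : Type*} [CommRing S] {n m : ℕ} (x : Fin m → Fin n → S) : Prop :=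
  ∀ i j : Fin 3 → Fin m, InDN₂ (x (i 0) - x (j 0)) (x (i 1) - x (j 1)) (x (i 2) - x (j 2))

section Manifold

variable (J : GrothendieckTopology C) (R : Cᵒᵖ ⥤ CommAlgCat.{w} ℚ) (M : Cᵒᵖ ⥤ Type w) (n : ℕ)

/-- `⟨P, Q⟩ ∈ M⟨2⟩`: the nil-square (first-order) neighbour relation, the joint image of those of the
charts. -/
def Nbr₁ {c : C} (P Q : M.obj (op c)) : Prop :=
  ∃ S ∈ J c, ∀ {c' : C} (f : c' ⟶ c), S f → ∃ κ : Chart J R M n c',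
    rst M f P ∈ κ.dom.carrier (𝟙 c') ∧ rst M f Q ∈ κ.dom.carrier (𝟙 c') ∧
    InD (κ.coord (𝟙 c') (rst M f Q) - κ.coord (𝟙 c') (rst M f P))

/-- `⟨P₁, …, Pₘ⟩ ∈ M₂⟨m⟩`: the joint image of the second-order i-structures of the charts. -/
def Nbr₂ {c : C} {m : ℕ} (P : Fin m → M.obj (op c)) : Prop :=
  m = 0 ∨ ∃ S ∈ J c, ∀ {c' : C} (f : c' ⟶ c), S f → ∃ κ : Chart J R M n c',
    (∀ i, rst M f (P i) ∈ κ.dom.carrier (𝟙 c')) ∧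
    Nbr₂Vec (fun i => κ.coord (𝟙 c') (rst M f (P i)))

variable {M}

theorem rst_rst {c c' c'' : C} (f : c' ⟶ c) (g : c'' ⟶ c') (x : M.obj (op c)) :
    rst M g (rst M f x) = rst M (g ≫ f) x := by
  simp [rst]

theorem rst_id {c : C} (x : M.obj (op c)) : rst M (𝟙 c) x = x := by
  simp [rst]

variable {J R n}

/-- The second-order i-structure `M₂` of a formal manifold `M`. -/
def secondOrder (hM : IsFormalManifold J R M n) : IStructure J M where
  nbr x := Nbr₂ J R M n x
  restrict {c c'} f m x hx := by
    rcases hx with h | ⟨S, hS, h⟩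
    · exact Or.inl h
    · refine Or.inr ⟨S.pullback f, J.pullback_stable f hS, fun {c''} g hg => ?_⟩
      obtain ⟨κ, h1, h2⟩ := h (g ≫ f) hg
      refine ⟨κ, fun i => ?_, ?_⟩
      · rw [rst_rst]; exact h1 i
      · simpa only [rst_rst] using h2
  isLocal {c m} x S hS h := by
    by_cases hm : m = 0
    · exact Or.inl hm
    · have h' : ∀ {c' : C} (f : c' ⟶ c), S f → ∃ T ∈ J c', ∀ {c'' : C} (g : c'' ⟶ c'), T g →
          ∃ κ : Chart J R M n c'', (∀ i, rst M (g ≫ f) (x i) ∈ κ.dom.carrier (𝟙 c'')) ∧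
            Nbr₂Vec (fun i => κ.coord (𝟙 c'') (rst M (g ≫ f) (x i))) := by
        intro c' f hf
        obtain ⟨T, hT, h⟩ := (h f hf).resolve_left hm
        refine ⟨T, hT, fun g hg => ?_⟩
        simpa only [rst_rst] using h g hg
      choose T hT hc using @h'
      refine Or.inr ⟨Sieve.bind S.arrows (fun _ f hf => T f hf),
        J.bind_covering hS (fun _ f hf => hT f hf), ?_⟩
      rintro c' _ ⟨c'', g, f, hf, hg, rfl⟩
      exact hc f hf g hg
  nbr_zero x := Or.inl rfl
  nbr_one {c} x := by
    obtain ⟨S, hS, h⟩ := hM.cover (x 0)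
    refine Or.inr ⟨S, hS, fun f hf => ?_⟩
    obtain ⟨κ, hκ⟩ := h f hf
    refine ⟨κ, fun i => by rw [Subsingleton.elim i 0]; exact hκ, fun i j => ?_⟩
    have e : i = j := Subsingleton.elim i j
    subst e
    simp [InDN₂, InD₂]
  reindex {c m k} h x hx := by
    rcases hx with h0 | ⟨S, hS, hc⟩
    · subst h0
      refine Or.inl ?_
      rcases Nat.eq_zero_or_pos m with hm | hm
      · exact hm
      · exact (h ⟨0, hm⟩).elim0
    · refine Or.inr ⟨S, hS, fun f hf => ?_⟩
      obtain ⟨κ, h1, h2⟩ := hc f hf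
      exact ⟨κ, fun i => h1 (h i), fun i j => h2 (h ∘ i) (h ∘ j)⟩

end Manifold

/-! ### Monads and infinitesimal groups -/

section Monad

variable {J : GrothendieckTopology C} {A : Cᵒᵖ ⥤ Type w}

theorem IStructure.restrict_cons (I : IStructure J A) {c c' : C} (f : c' ⟶ c) {m : ℕ}
    {P : A.obj (op c)} {x : Fin m → A.obj (op c)} (h : I.nbr (Matrix.vecCons P x)) :
    I.nbr (Matrix.vecCons (rst A f P) (fun i => rst A f (x i))) := by
  have := I.restrict f _ h
  convert this using 1
  funext i
  refine Fin.cases ?_ (fun i => ?_) i <;> simp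

theorem IStructure.restrict_pair (I : IStructure J A) {c c' : C} (f : c' ⟶ c)
    {P Q : A.obj (op c)} (h : I.nbr ![P, Q]) : I.nbr ![rst A f P, rst A f Q] := by
  have := I.restrict_cons f h
  convert this using 2
  funext i
  rw [Subsingleton.elim i 0]
  rfl

/-- The monad of `P ∈ A(c)`, a space over the stage `c` (a presheaf on `C/c`):
its elements are the `Q` with `⟨P, Q⟩ ∈ A⟨2⟩`. -/
def monad (I : IStructure J A) {c : C} (P : A.obj (op c)) : (Over c)ᵒᵖ ⥤ Type w where
  obj X := {Q : A.obj (op X.unop.left) // I.nbr ![rst A X.unop.hom P, Q]}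
  map {X Y} f := TypeCat.ofHom (fun Q => ⟨rst A f.unop.left Q.1, by
    have := I.restrict_pair f.unop.left Q.2
    rwa [rst_rst, Over.w] at this⟩)
  map_id X := by
    ext Q
    exact rst_id Q.1
  map_comp f g := by
    ext Q
    exact (rst_rst f.unop.left g.unop.left Q.1).symm

/-- The induced i-structure on the monad of `P`:
`⟨Q₁, …, Qₘ⟩` are neighbours in the monad if `⟨P, Q₁, …, Qₘ⟩ ∈ A⟨m+1⟩`. -/
def monadIStructure (I : IStructure J A) {c : C} (P : A.obj (op c)) :
    IStructure (J.over c) (monad I P) where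
  nbr {X m} Q := I.nbr (Matrix.vecCons (rst A X.hom P) (fun i => (Q i).1))
  restrict {X Y} f m Q h := by
    have := I.restrict_cons f.left h
    rwa [rst_rst, Over.w] at this
  isLocal {X m} Q S hS h := by
    refine I.isLocal _ (Sieve.overEquiv X S) hS (fun {c'} f hf => ?_)
    rw [Sieve.overEquiv_iff] at hf
    have key : (fun i => rst A f (Matrix.vecCons (rst A X.hom P) (fun i => (Q i).1) i)) =
        Matrix.vecCons (rst A (f ≫ X.hom) P) (fun i => rst A f (Q i).1) := by
      funext i
      refine Fin.cases ?_ (fun i => ?_) i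
      · simp [rst_rst]
      · rfl
    rw [key]
    exact h _ hf
  nbr_zero x := I.nbr_one _
  nbr_one {X} Q := by
    have := (Q 0).2
    convert this using 2
    funext i
    rw [Subsingleton.elim i 0]
    rfl
  reindex {X m k} h Q hQ := by
    have := I.reindex (Fin.cases 0 (fun i => (h i).succ) : Fin (m + 1) → Fin (k + 1)) _ hQ
    convert this using 1
    funext i
    refine Fin.cases ?_ (fun i => ?_) i <;> simp

/-- An infinitesimal group structure on a space `A` with i-structure `I`. (Proofs that a pair belongs to
the domain `A⟨2⟩` of the product are quantified universally in the equations; such proofs exist by the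
neighbourhood axioms.) -/
structure IGroup (I : IStructure J A) where
  mul : ∀ {c : C} (P Q : A.obj (op c)), I.nbr ![P, Q] → A.obj (op c)
  inv : ∀ {c : C}, A.obj (op c) → A.obj (op c)
  e : ∀ c : C, A.obj (op c)
  mul_natural : ∀ {c c' : C} (f : c' ⟶ c) (P Q : A.obj (op c)) (h : I.nbr ![P, Q])
    (h' : I.nbr ![rst A f P, rst A f Q]), rst A f (mul P Q h) = mul (rst A f P) (rst A f Q) h'
  inv_natural : ∀ {c c' : C} (f : c' ⟶ c) (P : A.obj (op c)), rst A f (inv P) = inv (rst A f P)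
  e_natural : ∀ {c c' : C} (f : c' ⟶ c), rst A f (e c) = e c'
  nbr_mul : ∀ {c : C} {m : ℕ} (P Q : A.obj (op c)) (x : Fin m → A.obj (op c)) (h : I.nbr ![P, Q]),
    I.nbr (Matrix.vecCons P (Matrix.vecCons Q x)) → I.nbr (Matrix.vecCons (mul P Q h) x)
  nbr_inv : ∀ {c : C} {m : ℕ} (P : A.obj (op c)) (x : Fin m → A.obj (op c)),
    I.nbr (Matrix.vecCons P x) → I.nbr (Matrix.vecCons (inv P) x)
  nbr_e : ∀ {c : C} {m : ℕ} (x : Fin m → A.obj (op c)),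
    I.nbr x → I.nbr (Matrix.vecCons (e c) x)
  assoc : ∀ {c : C} (P Q S : A.obj (op c)), I.nbr ![P, Q, S] →
    ∀ (hPQ : I.nbr ![P, Q]) (hQS : I.nbr ![Q, S]) (h : I.nbr ![mul P Q hPQ, S])
      (h' : I.nbr ![P, mul Q S hQS]), mul (mul P Q hPQ) S h = mul P (mul Q S hQS) h'
  e_mul : ∀ {c : C} (P : A.obj (op c)) (h : I.nbr ![e c, P]), mul (e c) P h = P
  mul_e : ∀ {c : C} (P : A.obj (op c)) (h : I.nbr ![P, e c]), mul P (e c) h = P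
  mul_inv : ∀ {c : C} (P : A.obj (op c)) (h : I.nbr ![P, inv P]), mul P (inv P) h = e c
  inv_mul : ∀ {c : C} (P : A.obj (op c)) (h : I.nbr ![inv P, P]), mul (inv P) P h = e c

end Monad

/-! ### Affine connections -/

/-- An affine connection (on points) on `M`. -/
structure AffineConnection (J : GrothendieckTopology C) (R : Cᵒᵖ ⥤ CommAlgCat.{w} ℚ)
    (M : Cᵒᵖ ⥤ Type w) (n : ℕ) where
  op : ∀ {c : C} (P Q S : M.obj (op c)), Nbr₁ J R M n P Q → Nbr₁ J R M n P S → M.obj (op c)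
  natural : ∀ {c c' : C} (f : c' ⟶ c) (P Q S : M.obj (.op c))
    (hQ : Nbr₁ J R M n P Q) (hS : Nbr₁ J R M n P S)
    (hQ' : Nbr₁ J R M n (rst M f P) (rst M f Q)) (hS' : Nbr₁ J R M n (rst M f P) (rst M f S)),
    rst M f (op P Q S hQ hS) = op (rst M f P) (rst M f Q) (rst M f S) hQ' hS'
  op_right : ∀ {c : C} (P Q : M.obj (.op c)) (hQ : Nbr₁ J R M n P Q) (hP : Nbr₁ J R M n P P),
    op P Q P hQ hP = Q
  op_left : ∀ {c : C} (P S : M.obj (.op c)) (hP : Nbr₁ J R M n P P) (hS : Nbr₁ J R M n P S),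
    op P P S hP hS = S

section Coefficients

variable {S : Type*} [CommRing S] [Algebra ℚ S] {n : ℕ}

/-- The value of the bilinear map `Sⁿ × Sⁿ → Sⁿ` with coefficients `B`. -/
def bil (B : Fin n → Fin n → Fin n → S) (x y : Fin n → S) : Fin n → S :=
  fun k => ∑ i, ∑ j, B k i j * (x i * y j)

/-- The symmetrisation of a bilinear map; for the symbol of a connection `λ` it is the symbol of
the symmetrised connection `½ λ + ½ λᵒᵖ`. -/
def symmCoeff (Γ : Fin n → Fin n → Fin n → S) : Fin n → Fin n → Fin n → S :=
  fun k i j => (1 / 2 : ℚ) • (Γ k i j + Γ k j i)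

/-- The second-order logarithm at the point `p` in a chart, for a symmetric connection
symbol `Γ` at `p`; tangent vectors are identified with their principal parts. -/
def logAt (Γ : Fin n → Fin n → Fin n → S) (p x : Fin n → S) : Fin n → S :=
  (x - p) - (1 / 2 : ℚ) • bil Γ (x - p) (x - p)

/-- The second-order exponential at the point `p` in a chart, for a symmetric connection
symbol `Γ` at `p`. -/
def expAt (Γ : Fin n → Fin n → Fin n → S) (p t : Fin n → S) : Fin n → S :=
  p + t + (1 / 2 : ℚ) • bil Γ t t

end Coefficients

/-- Restriction of the coefficients of a bilinear map to a later stage. -/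
def cres (R : Cᵒᵖ ⥤ CommAlgCat.{w} ℚ) {n : ℕ} {c c' : C} (f : c' ⟶ c)
    (B : Fin n → Fin n → Fin n → Scal R c) : Fin n → Fin n → Fin n → Scal R c' :=
  fun k i j => sres R f (B k i j)

namespace AffineConnection

variable {J : GrothendieckTopology C} {R : Cᵒᵖ ⥤ CommAlgCat.{w} ℚ} {M : Cᵒᵖ ⥤ Type w} {n : ℕ}

/-- `T` is the torsion `τ_P(Q, S) = λ(λ(P, Q, S), Q, S)`. -/
def IsTorsion (lam : AffineConnection J R M n) {c : C} (P Q S T : M.obj (.op c)) : Prop :=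
  ∃ (hQ : Nbr₁ J R M n P Q) (hS : Nbr₁ J R M n P S)
    (hQ' : Nbr₁ J R M n (lam.op P Q S hQ hS) Q) (hS' : Nbr₁ J R M n (lam.op P Q S hQ hS) S),
    lam.op (lam.op P Q S hQ hS) Q S hQ' hS' = T

/-- `Γ` is the connection symbol of `lam` at `P` in the chart `κ`:
`λ(P, Q, S) = Q + S - P + Γ[Q - P, S - P]` for all first-order neighbours `Q`, `S` of `P`. -/
def IsSymbol (lam : AffineConnection J R M n) {c : C} (κ : Chart J R M n c) (P : M.obj (.op c))
    (Γ : Fin n → Fin n → Fin n → Scal R c) : Prop :=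
  ∀ {c' : C} (f : c' ⟶ c) (Q S : M.obj (.op c'))
    (hQ : Nbr₁ J R M n (rst M f P) Q) (hS : Nbr₁ J R M n (rst M f P) S),
    Q ∈ κ.dom.carrier f ∧ S ∈ κ.dom.carrier f ∧ lam.op (rst M f P) Q S hQ hS ∈ κ.dom.carrier f ∧
    κ.coord f (lam.op (rst M f P) Q S hQ hS) =
      κ.coord f Q + κ.coord f S - κ.coord f (rst M f P) +
        bil (cres R f Γ) (κ.coord f Q - κ.coord f (rst M f P))
          (κ.coord f S - κ.coord f (rst M f P))

/-- `B` is the bracket on the tangent space at `P` given by minus the torsion, in the chart `κ`: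
`[t₁, t₂](d₁ d₂) = -τ_P(t₁(d₁), t₂(d₂))` for all tangent vectors `t₁`, `t₂` at `P`, with principal parts
`v₁`, `v₂`, and all `d₁, d₂ ∈ D`. The minus sign on the right is that of the linear structure of the monad
of `P`, with zero vector `P`. -/
def IsTorsionBracket (lam : AffineConnection J R M n) {c : C} (κ : Chart J R M n c)
    (P : M.obj (.op c)) (B : Fin n → Fin n → Fin n → Scal R c) : Prop :=
  ∀ {c' : C} (f : c' ⟶ c) (v₁ v₂ : Fin n → Scal R c') (d₁ d₂ : Scal R c'),
    d₁ * d₁ = 0 → d₂ * d₂ = 0 →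
    ∃ Q ∈ κ.dom.carrier f, ∃ S ∈ κ.dom.carrier f, ∃ T ∈ κ.dom.carrier f,
      κ.coord f Q = κ.coord f (rst M f P) + d₁ • v₁ ∧
      κ.coord f S = κ.coord f (rst M f P) + d₂ • v₂ ∧
      lam.IsTorsion (rst M f P) Q S T ∧
      κ.coord f (rst M f P) + (d₁ * d₂) • bil (cres R f B) v₁ v₂ =
        κ.coord f (rst M f P) - (κ.coord f T - κ.coord f (rst M f P))

end AffineConnection

/-- An infinitesimal group structure on the second-order monad `𝔐₂(P)`. -/
abbrev MonadGroup {J : GrothendieckTopology C} {R : Cᵒᵖ ⥤ CommAlgCat.{w} ℚ} {M : Cᵒᵖ ⥤ Type w} {n : ℕ}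
    (hM : IsFormalManifold J R M n) {c : C} (P : M.obj (op c)) :=
  IGroup (monadIStructure (secondOrder hM) P)

end SDG

/-! Work in a chart around `P` and write `q`, `s` for coordinates relative to `P`. The points `P`,
`Q`, `S` are second-order neighbours exactly when all coordinates of `q` and `s` lie in one ideal
`I` with `I * I * I = ⊥` (`nbr₂Vec_cons_iff`, `nbr₂_cons_iff`). So everything is computed modulo
cubes, and a bilinear map sees its arguments only up to `I * I` (`bil_perturb`).

The Kock-Lawvere axiom for `D(n)`, applied once in `S` and once in `Q`, gives `λ(P, Q, S)` the form
`q + s + Γ[q, s]` (`exists_symbol`). This expression makes sense on all of the second-order monad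
and serves as the product there. Both bracketings of a triple product equal `q + s + t + Γ[q, s] +
Γ[q, t] + Γ[s, t]`, and the inverse of `q` is `-q + Γ[q, q]`; no symmetry of `Γ` enters.

The product does not depend on the chart. By the axiom for `D₂(n)` a change of coordinates is `q ↦ A
q + H[q, q]` near `P` (`exists_transition`), and testing `λ` on first-order neighbours gives `A Γ[x,
y] + H[x, y] + H[y, x] = Γ'[A x, A y]` (`IsSymbol.transform`), which is what `change_of_coordinates`
needs. Being unique, products and inverses found locally glue (`exists_glue`).

For the torsion put `U = λ(P, Q, S)` with `q = d₁ v₁` and `s = d₂ v₂`. The symbol at `U` differs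
from that at `P` by terms in the ideal of `d₁` and `d₂` (`IsSymbol.sub_mem`), which the factor `d₁
d₂` kills. Hence `τ = P - d₁ d₂ (Γ[v₁, v₂] - Γ[v₂, v₁])`, and the bracket is the antisymmetrisation
of `Γ`. In the formula with `exp` and `log` the symmetrised symbol contributes `½ (Γ[q, s] + Γ[s,
q])` and the bracket `½ (Γ[q, s] - Γ[s, q])`, with sum `Γ[q, s]` (`expAt_log_add_log`). -/

namespace SDG

/-! ### Bilinear maps in coordinates and ideals with vanishing cube -/

section Bilinear

variable {S : Type*} [CommRing S] {n : ℕ}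

theorem bil_add_left (B : Fin n → Fin n → Fin n → S) (x x' y : Fin n → S) :
    bil B (x + x') y = bil B x y + bil B x' y := by
  funext k
  simp only [bil, Pi.add_apply, add_mul, mul_add, Finset.sum_add_distrib]

theorem bil_add_right (B : Fin n → Fin n → Fin n → S) (x y y' : Fin n → S) :
    bil B x (y + y') = bil B x y + bil B x y' := by
  funext k
  simp only [bil, Pi.add_apply, mul_add, Finset.sum_add_distrib]

theorem bil_smul_left (B : Fin n → Fin n → Fin n → S) (a : S) (x y : Fin n → S) :
    bil B (a • x) y = a • bil B x y := by
  funext k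
  simp only [bil, Pi.smul_apply, smul_eq_mul, Finset.mul_sum]
  exact Finset.sum_congr rfl fun i _ => Finset.sum_congr rfl fun j _ => by ring

theorem bil_smul_right (B : Fin n → Fin n → Fin n → S) (a : S) (x y : Fin n → S) :
    bil B x (a • y) = a • bil B x y := by
  funext k
  simp only [bil, Pi.smul_apply, smul_eq_mul, Finset.mul_sum]
  exact Finset.sum_congr rfl fun i _ => Finset.sum_congr rfl fun j _ => by ring

theorem bil_neg_left (B : Fin n → Fin n → Fin n → S) (x y : Fin n → S) :
    bil B (-x) y = -bil B x y := by
  simpa using bil_smul_left B (-1) x y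

theorem bil_neg_right (B : Fin n → Fin n → Fin n → S) (x y : Fin n → S) :
    bil B x (-y) = -bil B x y := by
  simpa using bil_smul_right B (-1) x y

theorem bil_zero_left (B : Fin n → Fin n → Fin n → S) (y : Fin n → S) : bil B 0 y = 0 := by
  simpa using bil_smul_left B 0 0 y

theorem bil_zero_right (B : Fin n → Fin n → Fin n → S) (x : Fin n → S) : bil B x 0 = 0 := by
  simpa using bil_smul_right B 0 x 0

theorem bil_eq_zero (B : Fin n → Fin n → Fin n → S) {x y : Fin n → S}
    (h : ∀ i j, x i * y j = 0) : bil B x y = 0 := by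
  funext k
  simp [bil, h]

theorem bil_sub_coeff (B B' : Fin n → Fin n → Fin n → S) (x y : Fin n → S) :
    bil (fun k i j => B k i j - B' k i j) x y = bil B x y - bil B' x y := by
  funext k
  simp only [bil, Pi.sub_apply, sub_mul, Finset.sum_sub_distrib]

theorem bil_add_coeff (B B' : Fin n → Fin n → Fin n → S) (x y : Fin n → S) :
    bil (fun k i j => B k i j + B' k i j) x y = bil B x y + bil B' x y := by
  funext k
  simp only [bil, Pi.add_apply, add_mul, Finset.sum_add_distrib]

theorem bil_swap_coeff (B : Fin n → Fin n → Fin n → S) (x y : Fin n → S) :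
    bil (fun k i j => B k j i) x y = bil B y x := by
  funext k
  simp only [bil]
  rw [Finset.sum_comm]
  exact Finset.sum_congr rfl fun i _ => Finset.sum_congr rfl fun j _ => by ring

/-- The bilinear map `(x, y) ↦ A (Γ[x, y])`. -/
theorem mulVec_bil (A : Matrix (Fin n) (Fin n) S) (B : Fin n → Fin n → Fin n → S)
    (x y : Fin n → S) :
    A.mulVec (bil B x y) = bil (fun k i j => ∑ l, A k l * B l i j) x y := by
  funext k
  simp only [bil, Matrix.mulVec, dotProduct, Finset.mul_sum, Finset.sum_mul]
  rw [Finset.sum_comm]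
  refine Finset.sum_congr rfl fun i _ => ?_
  rw [Finset.sum_comm]
  exact Finset.sum_congr rfl fun j _ => Finset.sum_congr rfl fun l _ => by ring

/-- The bilinear map `(x, y) ↦ Γ[A x, A y]`. -/
theorem bil_mulVec (A : Matrix (Fin n) (Fin n) S) (B : Fin n → Fin n → Fin n → S)
    (x y : Fin n → S) :
    bil B (A.mulVec x) (A.mulVec y) =
      bil (fun k i j => ∑ a, ∑ b, B k a b * (A a i * A b j)) x y := by
  funext k
  simp only [bil, Matrix.mulVec, dotProduct, Finset.mul_sum, Finset.sum_mul]
  have : ∀ F : Fin n → Fin n → Fin n → Fin n → S,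
      ∑ a, ∑ b, ∑ i, ∑ j, F a b i j = ∑ i, ∑ j, ∑ a, ∑ b, F a b i j := by
    intro F
    calc _ = ∑ a, ∑ i, ∑ b, ∑ j, F a b i j :=
          Finset.sum_congr rfl fun a _ => Finset.sum_comm
      _ = ∑ i, ∑ a, ∑ b, ∑ j, F a b i j := Finset.sum_comm
      _ = ∑ i, ∑ a, ∑ j, ∑ b, F a b i j :=
          Finset.sum_congr rfl fun i _ => Finset.sum_congr rfl fun a _ => Finset.sum_comm
      _ = _ := Finset.sum_congr rfl fun i _ => Finset.sum_comm
  rw [this, Finset.sum_comm]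
  refine Finset.sum_congr rfl fun i _ => Finset.sum_congr rfl fun j _ =>
    Finset.sum_congr rfl fun a _ => Finset.sum_congr rfl fun b _ => by ring

/-- All coordinates of the vector `x` lie in the ideal `I`. -/
def VecMem (I : Ideal S) (x : Fin n → S) : Prop := ∀ k, x k ∈ I

theorem VecMem.add {I : Ideal S} {x y : Fin n → S} (hx : VecMem I x) (hy : VecMem I y) :
    VecMem I (x + y) := fun k => I.add_mem (hx k) (hy k)

theorem VecMem.sub {I : Ideal S} {x y : Fin n → S} (hx : VecMem I x) (hy : VecMem I y) :
    VecMem I (x - y) := fun k => I.sub_mem (hx k) (hy k)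

theorem VecMem.neg {I : Ideal S} {x : Fin n → S} (hx : VecMem I x) : VecMem I (-x) :=
  fun k => I.neg_mem (hx k)

theorem VecMem.zero {I : Ideal S} : VecMem I (0 : Fin n → S) := fun _ => I.zero_mem

theorem VecMem.smul {K : Type*} [CommSemiring K] [Algebra K S] {I : Ideal S} {x : Fin n → S} (a : K)
    (hx : VecMem I x) : VecMem I (a • x) := fun k => by
  rw [Pi.smul_apply, Algebra.smul_def]
  exact I.mul_mem_left _ (hx k)

theorem VecMem.mono {I I' : Ideal S} (h : I ≤ I') {x : Fin n → S} (hx : VecMem I x) : VecMem I' x :=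
  fun k => h (hx k)

theorem VecMem.mulVec {I : Ideal S} {x : Fin n → S} (A : Matrix (Fin n) (Fin n) S)
    (hx : VecMem I x) : VecMem I (A.mulVec x) :=
  fun k => show ∑ j, A k j * x j ∈ I from I.sum_mem fun j _ => I.mul_mem_left (A k j) (hx j)

theorem VecMem.bil {I I' : Ideal S} {x y : Fin n → S} (B : Fin n → Fin n → Fin n → S)
    (hx : VecMem I x) (hy : VecMem I' y) : VecMem (I * I') (bil B x y) :=
  fun _ => Ideal.sum_mem _ fun _ _ => Ideal.sum_mem _ fun _ _ =>
    Ideal.mul_mem_left _ _ (Ideal.mul_mem_mul (hx _) (hy _))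

/-- Since `I * I ≤ I`, a quadratic map without constant term preserves `I`. This is why neighbour
relations survive a change of coordinates. -/
theorem VecMem.mulVec_add_bil {I : Ideal S} {d : Fin n → S} (A : Matrix (Fin n) (Fin n) S)
    (H : Fin n → Fin n → Fin n → S) (hd : VecMem I d) :
    VecMem I (A.mulVec d + SDG.bil H d d) :=
  (hd.mulVec A).add ((hd.bil H hd).mono Ideal.mul_le_right)

theorem VecMem.inD {I : Ideal S} (hI : I * I = ⊥) {x : Fin n → S} (hx : VecMem I x) : InD x :=
  fun i j => by
    have := Ideal.mul_mem_mul (hx i) (hx j)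
    rwa [hI] at this

theorem mul_mul_eq_zero_of_mem {I : Ideal S} (hI : I * I * I = ⊥) {a b c : S} (ha : a ∈ I)
    (hb : b ∈ I) (hc : c ∈ I) : a * b * c = 0 := by
  have := Ideal.mul_mem_mul (Ideal.mul_mem_mul ha hb) hc
  rwa [hI] at this

theorem VecMem.inD₂ {I : Ideal S} (hI : I * I * I = ⊥) {x : Fin n → S} (hx : VecMem I x) : InD₂ x :=
  fun i j k => mul_mul_eq_zero_of_mem hI (hx i) (hx j) (hx k)

/-- A bilinear map does not see perturbations of its arguments by terms of second order. -/
theorem bil_perturb {I : Ideal S} (hI : I * I * I = ⊥) (B : Fin n → Fin n → Fin n → S)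
    {x y u v : Fin n → S} (hx : VecMem I x) (hy : VecMem I y) (hu : VecMem (I * I) u)
    (hv : VecMem (I * I) v) : bil B (x + u) (y + v) = bil B x y := by
  have h1 : bil B x v = 0 := bil_eq_zero _ fun i j => by
    have := Ideal.mul_mem_mul (hv j) (hx i)
    rw [hI] at this
    rw [mul_comm]
    exact this
  have h2 : bil B u y = 0 := bil_eq_zero _ fun i j => by
    have := Ideal.mul_mem_mul (hu i) (hy j)
    rwa [hI] at this
  have h3 : bil B u v = 0 := bil_eq_zero _ fun i j => by
    have := Ideal.mul_mem_mul (hu i) (Ideal.mul_le_left (hv j))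
    rwa [hI] at this
  rw [bil_add_left, bil_add_right, bil_add_right, h1, h2, h3]
  simp

theorem InD.span_mul_span {d : Fin n → S} (hd : InD d) :
    Ideal.span (Set.range d) * Ideal.span (Set.range d) = ⊥ := by
  rw [Ideal.span_mul_span', Ideal.span_eq_bot]
  rintro _ ⟨_, ⟨i, rfl⟩, _, ⟨j, rfl⟩, rfl⟩
  exact hd i j

/-- Each of the two coordinate ideals has square zero, and among any three factors from two ideals
one ideal repeats. No relation between `d` and `e` is needed. -/
theorem InD.exists_cube_zero {d e : Fin n → S} (hd : InD d) (he : InD e) :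
    ∃ I : Ideal S, I * I * I = ⊥ ∧ VecMem I d ∧ VecMem I e := by
  refine ⟨Ideal.span (Set.range d) ⊔ Ideal.span (Set.range e), ?_,
    fun k => Ideal.mem_sup_left (Ideal.subset_span ⟨k, rfl⟩),
    fun k => Ideal.mem_sup_right (Ideal.subset_span ⟨k, rfl⟩)⟩
  have s1 := hd.span_mul_span
  have s2 := he.span_mul_span
  generalize Ideal.span (Set.range d) = I₁ at s1
  generalize Ideal.span (Set.range e) = I₂ at s2
  rw [← Ideal.zero_eq_bot] at s1 s2 ⊢
  rw [← Submodule.add_eq_sup]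
  calc (I₁ + I₂) * (I₁ + I₂) * (I₁ + I₂)
      = I₁ * I₁ * (I₁ + 3 * I₂) + I₂ * I₂ * (I₂ + 3 * I₁) := by ring
    _ = 0 := by rw [s1, s2, zero_mul, zero_mul, add_zero]

/-- The `InD₂` clauses of `InDN₂` are triple products with a repeated index pair, so they are
absorbed once the indices range freely. -/
theorem nbr₂Vec_iff {m : ℕ} (x : Fin m → Fin n → S) :
    Nbr₂Vec x ↔ ∀ i₀ j₀ i₁ j₁ i₂ j₂ a b c,
      (x i₀ a - x j₀ a) * (x i₁ b - x j₁ b) * (x i₂ c - x j₂ c) = 0 := by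
  constructor
  · intro h i₀ j₀ i₁ j₁ i₂ j₂ a b c
    simpa using (h ![i₀, i₁, i₂] ![j₀, j₁, j₂]).2 a b c
  · intro h i j
    exact ⟨⟨fun _ _ _ => h _ _ _ _ _ _ _ _ _, fun _ _ _ => h _ _ _ _ _ _ _ _ _,
      fun _ _ _ => h _ _ _ _ _ _ _ _ _⟩, fun _ _ _ => h _ _ _ _ _ _ _ _ _⟩

/-- `⟨p, x₁, …, xₘ⟩` are second-order neighbours iff all coordinates of the `xᵢ - p` lie in an ideal
with vanishing cube. -/
theorem nbr₂Vec_cons_iff {m : ℕ} (p : Fin n → S) (x : Fin m → Fin n → S) :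
    Nbr₂Vec (Matrix.vecCons p x) ↔ ∃ I : Ideal S, I * I * I = ⊥ ∧ ∀ i, VecMem I (x i - p) := by
  rw [nbr₂Vec_iff]
  constructor
  · intro h
    refine ⟨Ideal.span (Set.range fun a : Fin m × Fin n => x a.1 a.2 - p a.2), ?_,
      fun i k => Ideal.subset_span ⟨(i, k), rfl⟩⟩
    rw [Ideal.span_mul_span', Ideal.span_mul_span', Ideal.span_eq_bot]
    rintro _ ⟨_, ⟨_, ⟨i, rfl⟩, _, ⟨j, rfl⟩, rfl⟩, _, ⟨k, rfl⟩, rfl⟩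
    simpa using h i.1.succ 0 j.1.succ 0 k.1.succ 0 i.2 j.2 k.2
  · rintro ⟨I, hI, hx⟩ i₀ j₀ i₁ j₁ i₂ j₂ a b c
    have h : ∀ (i : Fin (m + 1)) (a : Fin n), Matrix.vecCons p x i a - p a ∈ I := by
      intro i a
      refine Fin.cases ?_ (fun i => ?_) i
      · simp
      · simpa using hx i a
    -- Differences not involving `p` are differences of differences from `p`.
    have h' : ∀ (i j : Fin (m + 1)) (a : Fin n),
        Matrix.vecCons p x i a - Matrix.vecCons p x j a ∈ I := by
      intro i j a
      simpa using I.sub_mem (h i a) (h j a)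
    exact mul_mul_eq_zero_of_mem hI (h' _ _ _) (h' _ _ _) (h' _ _ _)

/-- A product with second-order symbol `Γ` is compatible with a second-order change of coordinates
`q ↦ A q + H[q, q]` under which the symbol transforms as that of a connection. -/
theorem change_of_coordinates {I : Ideal S} (hI : I * I * I = ⊥) (A : Matrix (Fin n) (Fin n) S)
    (H Γ Γ' : Fin n → Fin n → Fin n → S)
    (hΓ : ∀ x y, A.mulVec (bil Γ x y) + bil H x y + bil H y x =
      bil Γ' (A.mulVec x) (A.mulVec y)) {q s : Fin n → S} (hq : VecMem I q) (hs : VecMem I s) :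
    A.mulVec (q + s + bil Γ q s) + bil H (q + s + bil Γ q s) (q + s + bil Γ q s) =
      (A.mulVec q + bil H q q) + (A.mulVec s + bil H s s) +
        bil Γ' (A.mulVec q + bil H q q) (A.mulVec s + bil H s s) := by
  -- `Γ'` sees only the linear parts `A q`, `A s`, and `H` only `q + s`; the cross terms of `H` are
  -- those of the transformation law.
  rw [bil_perturb hI _ (hq.mulVec A) (hs.mulVec A) (hq.bil H hq) (hs.bil H hs),
    bil_perturb hI _ (hq.add hs) (hq.add hs) (hq.bil Γ hs) (hq.bil Γ hs), ← hΓ]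
  simp only [Matrix.mulVec_add, bil_add_left, bil_add_right]
  abel

/-- The nested terms `Γ[Γ[q, s], t]` and `Γ[q, Γ[s, t]]` are cubic and vanish, leaving the same
three bilinear terms on both sides. -/
theorem assoc_of_cube_zero {I : Ideal S} (hI : I * I * I = ⊥) (Γ : Fin n → Fin n → Fin n → S)
    {q s t : Fin n → S} (hq : VecMem I q) (hs : VecMem I s) (ht : VecMem I t) :
    (q + s + bil Γ q s) + t + bil Γ (q + s + bil Γ q s) t =
      q + (s + t + bil Γ s t) + bil Γ q (s + t + bil Γ s t) := by
  have h1 := bil_perturb hI Γ (hq.add hs) ht (hq.bil Γ hs) VecMem.zero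
  have h2 := bil_perturb hI Γ hq (hs.add ht) VecMem.zero (hs.bil Γ ht)
  rw [add_zero] at h1 h2
  rw [h1, h2, bil_add_left, bil_add_right]
  abel

/-- The inverse for the product with symbol `Γ`. -/
theorem add_add_bil_eq_zero_iff {I : Ideal S} (hI : I * I * I = ⊥) (Γ : Fin n → Fin n → Fin n → S)
    {q t : Fin n → S} (hq : VecMem I q) (ht : VecMem I t) :
    q + t + bil Γ q t = 0 ↔ t = -q + bil Γ q q := by
  -- Any candidate inverse is `-q` up to second order, so its bilinear term is already known to be
  -- `-Γ[q, q]`.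
  have key : ∀ u, VecMem (I * I) u → bil Γ q (-q + u) = -bil Γ q q := by
    intro u hu
    have := bil_perturb hI Γ hq hq.neg VecMem.zero hu
    rwa [add_zero, bil_neg_right] at this
  constructor
  · intro h
    have e : t = -q + -bil Γ q t := by
      rw [← sub_eq_zero, ← h]
      abel
    have h2 := key _ (hq.bil Γ ht).neg
    rw [← e] at h2
    rw [h2, neg_neg] at e
    exact e
  · rintro rfl
    rw [key _ (hq.bil Γ hq)]
    abel

/-- The right inverse is also a left inverse, because only the diagonal value `Γ[q, q]` enters and
this does not see the order of the arguments. -/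
theorem inv_comm_of_cube_zero {I : Ideal S} (hI : I * I * I = ⊥) (Γ : Fin n → Fin n → Fin n → S)
    {q : Fin n → S} (hq : VecMem I q) :
    (-q + bil Γ q q) + q + bil Γ (-q + bil Γ q q) q = 0 := by
  have := bil_perturb hI Γ hq.neg hq (hq.bil Γ hq) VecMem.zero
  rw [add_zero, bil_neg_left] at this
  rw [this]
  abel

end Bilinear

/-! ### Second-order exponential and logarithm -/

section ExpLog

variable {S : Type*} [CommRing S] [Algebra ℚ S] {n : ℕ}

theorem bil_symmCoeff (Γ : Fin n → Fin n → Fin n → S) (x y : Fin n → S) :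
    bil (symmCoeff Γ) x y = (1 / 2 : ℚ) • (bil Γ x y + bil Γ y x) := by
  rw [← bil_swap_coeff Γ x y, ← bil_add_coeff]
  funext k
  simp only [bil, symmCoeff, Pi.smul_apply, Finset.smul_sum, smul_mul_assoc]

/-- The antisymmetric part of `Γ` vanishes on the diagonal, so `log` and `exp` may be computed with
`Γ` itself. -/
theorem bil_symmCoeff_self (Γ : Fin n → Fin n → Fin n → S) (x : Fin n → S) :
    bil (symmCoeff Γ) x x = bil Γ x x := by
  rw [bil_symmCoeff, ← two_smul ℚ, smul_smul]
  norm_num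

/-- The terms `-½ Γ[q, q]` and `-½ Γ[s, s]` of the logarithms cancel against the expansion of `½ Γ[q
+ s, q + s]`; the mixed terms left over combine with half the commutator of `Γ` to `Γ[q, s]`. -/
theorem expAt_log_add_log {I : Ideal S} (hI : I * I * I = ⊥) (Γ : Fin n → Fin n → Fin n → S)
    {p x y : Fin n → S} (hx : VecMem I (x - p)) (hy : VecMem I (y - p)) :
    expAt (symmCoeff Γ) p (logAt (symmCoeff Γ) p x + logAt (symmCoeff Γ) p y +
      (1 / 2 : ℚ) • bil (fun k i j => Γ k i j - Γ k j i) (logAt (symmCoeff Γ) p x)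
        (logAt (symmCoeff Γ) p y)) = x + y - p + bil Γ (x - p) (y - p) := by
  obtain ⟨q, rfl⟩ : ∃ q, x = p + q := ⟨x - p, by abel⟩
  obtain ⟨s, rfl⟩ : ∃ s, y = p + s := ⟨y - p, by abel⟩
  simp only [expAt, logAt, add_sub_cancel_left, bil_symmCoeff_self] at hx hy ⊢
  have hu := ((hx.bil Γ hx).smul (1 / 2 : ℚ)).neg
  have hv := ((hy.bil Γ hy).smul (1 / 2 : ℚ)).neg
  have h1 : bil (fun k i j => Γ k i j - Γ k j i) (q - (1 / 2 : ℚ) • bil Γ q q)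
      (s - (1 / 2 : ℚ) • bil Γ s s) = bil Γ q s - bil Γ s q := by
    rw [sub_eq_add_neg, sub_eq_add_neg, bil_perturb hI _ hx hy hu hv, bil_sub_coeff, bil_swap_coeff Γ q s]
  rw [h1]
  -- All corrections to `q + s` together lie in `I * I`, so the quadratic term of `exp` does not see
  -- them.
  have hw := (hu.add hv).add (((hx.bil Γ hy).sub ((mul_comm I I) ▸ hy.bil Γ hx)).smul (1 / 2 : ℚ))
  have h2 : q - (1 / 2 : ℚ) • bil Γ q q + (s - (1 / 2 : ℚ) • bil Γ s s) +
      (1 / 2 : ℚ) • (bil Γ q s - bil Γ s q) = (q + s) + (-((1 / 2 : ℚ) • bil Γ q q) +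
        -((1 / 2 : ℚ) • bil Γ s s) + (1 / 2 : ℚ) • (bil Γ q s - bil Γ s q)) := by abel
  rw [h2, bil_perturb hI _ (hx.add hy) (hx.add hy) hw hw]
  simp only [bil_add_left, bil_add_right]
  module

/-- Negation turns the correction of `log` into `+½ Γ[q, q]`, and `exp` adds another `½ Γ[q, q]`:
the chart formula for the inverse. -/
theorem expAt_neg_log {I : Ideal S} (hI : I * I * I = ⊥) (Γ : Fin n → Fin n → Fin n → S)
    {p x : Fin n → S} (hx : VecMem I (x - p)) :
    expAt (symmCoeff Γ) p (-logAt (symmCoeff Γ) p x) = p + (-(x - p) + bil Γ (x - p) (x - p)) := by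
  obtain ⟨q, rfl⟩ : ∃ q, x = p + q := ⟨x - p, by abel⟩
  simp only [expAt, logAt, add_sub_cancel_left, bil_symmCoeff_self] at hx ⊢
  have hu := (hx.bil Γ hx).smul (1 / 2 : ℚ)
  rw [neg_sub', sub_neg_eq_add, bil_perturb hI _ hx.neg hx.neg hu hu, bil_neg_left, bil_neg_right]
  module

end ExpLog

variable {C : Type u} [Category.{v} C]

/-! ### Restriction of vectors and coefficients -/

section Restriction

variable {R : Cᵒᵖ ⥤ CommAlgCat.{w} ℚ} {n : ℕ} {c c' c'' : C}

/-- Restriction of matrices to a later stage. -/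
def mres (R : Cᵒᵖ ⥤ CommAlgCat.{w} ℚ) {n : ℕ} {c c' : C} (f : c' ⟶ c)
    (A : Matrix (Fin n) (Fin n) (Scal R c)) : Matrix (Fin n) (Fin n) (Scal R c') :=
  fun i j => sres R f (A i j)

@[simp] theorem vres_id (x : Fin n → Scal R c) : vres R (𝟙 c) x = x :=
  funext fun _ => sres_id R _

theorem vres_vres (f : c' ⟶ c) (g : c'' ⟶ c') (x : Fin n → Scal R c) :
    vres R g (vres R f x) = vres R (g ≫ f) x :=
  funext fun _ => (sres_comp R f g _).symm

theorem vres_add (f : c' ⟶ c) (x y : Fin n → Scal R c) :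
    vres R f (x + y) = vres R f x + vres R f y :=
  funext fun _ => map_add (sres R f) _ _

theorem vres_sub (f : c' ⟶ c) (x y : Fin n → Scal R c) :
    vres R f (x - y) = vres R f x - vres R f y :=
  funext fun _ => map_sub (sres R f) _ _

@[simp] theorem vres_zero (f : c' ⟶ c) : vres R f (0 : Fin n → Scal R c) = 0 :=
  funext fun _ => map_zero (sres R f)

@[simp] theorem mres_id (A : Matrix (Fin n) (Fin n) (Scal R c)) : mres R (𝟙 c) A = A :=
  funext fun _ => funext fun _ => sres_id R _

theorem mres_mres (f : c' ⟶ c) (g : c'' ⟶ c') (A : Matrix (Fin n) (Fin n) (Scal R c)) :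
    mres R g (mres R f A) = mres R (g ≫ f) A :=
  funext fun _ => funext fun _ => (sres_comp R f g _).symm

theorem vres_mulVec (f : c' ⟶ c) (A : Matrix (Fin n) (Fin n) (Scal R c)) (x : Fin n → Scal R c) :
    vres R f (A.mulVec x) = (mres R f A).mulVec (vres R f x) := by
  funext k
  simp [vres, mres, Matrix.mulVec, dotProduct]

@[simp] theorem cres_id (B : Fin n → Fin n → Fin n → Scal R c) : cres R (𝟙 c) B = B :=
  funext fun _ => funext fun _ => funext fun _ => sres_id R _

theorem cres_cres (f : c' ⟶ c) (g : c'' ⟶ c') (B : Fin n → Fin n → Fin n → Scal R c) :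
    cres R g (cres R f B) = cres R (g ≫ f) B :=
  funext fun _ => funext fun _ => funext fun _ => (sres_comp R f g _).symm

theorem vres_bil (f : c' ⟶ c) (B : Fin n → Fin n → Fin n → Scal R c) (x y : Fin n → Scal R c) :
    vres R f (bil B x y) = bil (cres R f B) (vres R f x) (vres R f y) := by
  funext k
  simp [vres, cres, bil]

theorem InD.inD₂ {S : Type*} [CommRing S] {d : Fin n → S} (h : InD d) : InD₂ d :=
  fun i j k => by rw [h, zero_mul]

end Restriction

/-! ### Local equality and gluing in sheaves -/

section Separated

variable {J : GrothendieckTopology C} {R : Cᵒᵖ ⥤ CommAlgCat.{w} ℚ} {M : Cᵒᵖ ⥤ Type w}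

theorem eq_of_locally_eq (hM : Presieve.IsSheaf J M) {c : C} {x y : M.obj (op c)} {S : Sieve c}
    (hS : S ∈ J c) (h : ∀ {c' : C} (f : c' ⟶ c), S f → rst M f x = rst M f y) : x = y :=
  (hM S hS).isSeparatedFor.ext fun _ f hf => h f hf

theorem IsKockLawvere.eq_of_locally_eq (hR : IsKockLawvere J R) {c : C} {x y : Scal R c}
    {S : Sieve c} (hS : S ∈ J c)
    (h : ∀ {c' : C} (f : c' ⟶ c), S f → sres R f x = sres R f y) : x = y :=
  (hR.isSheaf S hS).isSeparatedFor.ext fun _ f hf => h f hf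

/-- Elements of a sheaf can be constructed locally if they are unique. -/
theorem exists_glue (hM : Presieve.IsSheaf J M) {c : C}
    (Φ : ∀ {c' : C}, (c' ⟶ c) → M.obj (op c') → Prop)
    (restrict : ∀ {c' c'' : C} (f : c' ⟶ c) (g : c'' ⟶ c') (x : M.obj (op c')),
      Φ f x → Φ (g ≫ f) (rst M g x))
    (unique : ∀ {c' : C} (f : c' ⟶ c) (x y : M.obj (op c')), Φ f x → Φ f y → x = y)
    {S : Sieve c} (hS : S ∈ J c) (h : ∀ {c' : C} (f : c' ⟶ c), S f → ∃ x, Φ f x) :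
    ∃ x : M.obj (op c), ∀ {c' : C} (f : c' ⟶ c), S f → Φ f (rst M f x) := by
  choose x hx using @h
  obtain ⟨t, ht, -⟩ := hM S hS (fun _ f hf => x f hf) (by
    intro c₁ c₂ c' g₁ g₂ f₁ f₂ h₁ h₂ e
    have e₁ := restrict f₁ g₁ _ (hx f₁ h₁)
    have e₂ := restrict f₂ g₂ _ (hx f₂ h₂)
    rw [← e] at e₂
    exact unique _ _ _ e₁ e₂)
  refine ⟨t, fun f hf => ?_⟩
  have : rst M f t = x f hf := ht f hf
  rw [this]
  exact hx f hf

end Separated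

/-! ### Consequences of the Kock-Lawvere axioms in all dimensions -/

section KockLawvere

variable {J : GrothendieckTopology C} {R : Cᵒᵖ ⥤ CommAlgCat.{w} ℚ} {X : Cᵒᵖ ⥤ Type w} {n : ℕ}

@[simp] theorem rst_D_val {c c' : C} (f : c' ⟶ c) (d : (D R n).obj (op c)) :
    (rst (D R n) f d).1 = vres R f d.1 := rfl

@[simp] theorem rst_D₂_val {c c' : C} (f : c' ⟶ c) (d : (D₂ R n).obj (op c)) :
    (rst (D₂ R n) f d).1 = vres R f d.1 := rfl

@[simp] theorem D.zero_val (c : C) : (D.zero R n c).1 = 0 := rfl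

@[simp] theorem D₂.zero_val (c : C) : (D₂.zero R n c).1 = 0 := rfl

theorem rst_D_zero {c c' : C} (f : c' ⟶ c) : rst (D R n) f (D.zero R n c) = D.zero R n c' :=
  Subtype.ext (by simp)

theorem rst_D₂_zero {c c' : C} (f : c' ⟶ c) : rst (D₂ R n) f (D₂.zero R n c) = D₂.zero R n c' :=
  Subtype.ext (by simp)

/-- Formal openness is assumed for `m ≥ 1` only. `D(0)` is a point, and a map on it extends to a
constant map on `D(1)`; so models of dimension `0` need no separate treatment later. -/
theorem FormallyOpen.first_mem {c : C} {U : ∀ {c' : C}, (c' ⟶ c) → Set (X.obj (op c'))}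
    (hU : FormallyOpen R X U) (m : ℕ) {c' : C} (f : c' ⟶ c) (t : StageMap (D R m) X c')
    (h : t.app (𝟙 c') (D.zero R m c') ∈ U f) {c'' : C} (g : c'' ⟶ c')
    (d : (D R m).obj (op c'')) : t.app g d ∈ U (g ≫ f) := by
  rcases Nat.eq_zero_or_pos m with rfl | hm
  · have := hU.first 1 le_rfl f ⟨fun g _ => t.app g (D.zero R 0 _), fun f g _ => by
      rw [t.natural, rst_D_zero]⟩ h g (D.zero R 1 c'')
    convert this using 1
    exact congrArg _ (Subtype.ext (Subsingleton.elim _ _))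
  · exact hU.first m hm f t h g d

theorem FormallyOpen.second_mem {c : C} {U : ∀ {c' : C}, (c' ⟶ c) → Set (X.obj (op c'))}
    (hU : FormallyOpen R X U) (m : ℕ) {c' : C} (f : c' ⟶ c) (t : StageMap (D₂ R m) X c')
    (h : t.app (𝟙 c') (D₂.zero R m c') ∈ U f) {c'' : C} (g : c'' ⟶ c')
    (d : (D₂ R m).obj (op c'')) : t.app g d ∈ U (g ≫ f) := by
  rcases Nat.eq_zero_or_pos m with rfl | hm
  · have := hU.second 1 le_rfl f ⟨fun g _ => t.app g (D₂.zero R 0 _), fun f g _ => by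
      rw [t.natural, rst_D₂_zero]⟩ h g (D₂.zero R 1 c'')
    convert this using 1
    exact congrArg _ (Subtype.ext (Subsingleton.elim _ _))
  · exact hU.second m hm f t h g d

theorem FormallyOpen.pull {c c' : C} {U : ∀ {c' : C}, (c' ⟶ c) → Set (X.obj (op c'))}
    (hU : FormallyOpen R X U) (f : c' ⟶ c) : FormallyOpen R X (fun g => U (g ≫ f)) where
  first m hm _ g t h _ k d := by
    rw [Category.assoc]
    exact hU.first m hm (g ≫ f) t h k d
  second m hm _ g t h _ k d := by
    rw [Category.assoc]
    exact hU.second m hm (g ≫ f) t h k d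

/-- The `k`-th coordinate of a map into `Rⁿ`. -/
def StageMap.coordinate {A : Cᵒᵖ ⥤ Type w} {c : C} (t : StageMap A (affineSpace R n) c) (k : Fin n) :
    StageMap A (affineSpace R 1) c where
  app f d := fun _ => t.app f d k
  natural f g d := by
    rw [← t.natural f g d]
    rfl

/-- The axiom concerns values in `R` and `n ≥ 1`; it is used coordinatewise, and for `n = 0` the
target is a point. -/
theorem IsKockLawvere.exists_affine (hR : IsKockLawvere J R) {c : C}
    (t : StageMap (D R n) (affineSpace R n) c) :
    ∃ (a : Fin n → Scal R c) (A : Matrix (Fin n) (Fin n) (Scal R c)),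
      ∀ {c' : C} (f : c' ⟶ c) (d : (D R n).obj (op c')),
        t.app f d = vres R f a + (mres R f A).mulVec d.1 := by
  rcases Nat.eq_zero_or_pos n with rfl | hn
  · exact ⟨0, 0, fun _ _ => Subsingleton.elim (α := Fin 0 → _) _ _⟩
  · choose a ha using fun k => (hR.first n hn c (t.coordinate k)).exists
    exact ⟨fun k => (a k).1, fun k => (a k).2, fun f d => funext fun k => ha k f d⟩

/-- This is the uniqueness half of the axiom, row by row: universally quantified first-order
infinitesimals can be cancelled. -/
theorem IsKockLawvere.matrix_ext (hR : IsKockLawvere J R) {c : C}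
    {A A' : Matrix (Fin n) (Fin n) (Scal R c)}
    (h : ∀ {c' : C} (f : c' ⟶ c) (d : Fin n → Scal R c'), InD d →
      (mres R f A).mulVec d = (mres R f A').mulVec d) : A = A' := by
  rcases Nat.eq_zero_or_pos n with rfl | hn
  · exact Subsingleton.elim _ _
  · let t : StageMap (D R n) (affineSpace R n) c :=
      ⟨fun f d => (mres R f A).mulVec d.1, fun f g d => by
        refine (vres_mulVec g _ _).trans ?_
        rw [mres_mres]
        rfl⟩
    funext k
    have e := (hR.first n hn c (t.coordinate k)).unique (y₁ := (0, A k)) (y₂ := (0, A' k))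
      (fun f d => by
        simp only [map_zero, zero_add]
        rfl)
      (fun f d => by
        simp only [map_zero, zero_add]
        exact congrFun (h f d.1 d.2) k)
    exact congrArg Prod.snd e

/-- A bilinear map is determined by its values on first-order infinitesimals. -/
theorem IsKockLawvere.bil_ext (hR : IsKockLawvere J R) {c : C}
    {B B' : Fin n → Fin n → Fin n → Scal R c}
    (h : ∀ {c' : C} (f : c' ⟶ c) (d e : Fin n → Scal R c'), InD d → InD e →
      bil (cres R f B) d e = bil (cres R f B') d e) : B = B' := by
  have key : ∀ {S : Type w} [CommRing S] (B : Fin n → Fin n → Fin n → S) (d e : Fin n → S),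
      bil B d e = Matrix.mulVec (fun k j => ∑ i, B k i j * d i) e := by
    intro S _ B d e
    funext k
    simp only [bil, Matrix.mulVec, dotProduct, Finset.sum_mul]
    rw [Finset.sum_comm]
    exact Finset.sum_congr rfl fun _ _ => Finset.sum_congr rfl fun _ _ => by ring
  have hm : ∀ {c' c'' : C} (g : c'' ⟶ c') (B : Fin n → Fin n → Fin n → Scal R c')
      (d : Fin n → Scal R c'), mres R g (fun k j => ∑ i, B k i j * d i) =
        fun k j => ∑ i, cres R g B k i j * vres R g d i := by
    intro c' c'' g B d
    funext k j
    simp [mres, cres, vres]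
  -- First `e` is cancelled with `d` fixed at its stage, then `d` with the column `j` fixed.
  have h1 : ∀ {c' : C} (f : c' ⟶ c) (d : Fin n → Scal R c'), InD d → ∀ k j,
      ∑ i, cres R f B k i j * d i = ∑ i, cres R f B' k i j * d i := by
    intro c' f d hd k j
    have := hR.matrix_ext (A := fun k j => ∑ i, cres R f B k i j * d i)
      (A' := fun k j => ∑ i, cres R f B' k i j * d i) (fun {c''} g e he => by
        have := h (g ≫ f) (vres R g d) e (hd.vres R g) he
        rw [key, key, ← cres_cres, ← cres_cres] at this
        rwa [← hm, ← hm] at this)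
    exact congrFun (congrFun this k) j
  funext k i j
  have := hR.matrix_ext (A := fun k i => B k i j) (A' := fun k i => B' k i j)
    (fun f d hd => funext fun k => h1 f d hd k j)
  exact congrFun (congrFun this k) i

/-- The axiom lists one coefficient per monomial `dᵢ dⱼ` with `i ≤ j`. Extending by `0` gives a
triangular `H`, which is not symmetric; this is why both `H[x, y]` and `H[y, x]` occur in the
transformation law. -/
theorem IsKockLawvere.exists_quadratic (hR : IsKockLawvere J R) {c : C}
    (t : StageMap (D₂ R n) (affineSpace R n) c) :
    ∃ (a : Fin n → Scal R c) (A : Matrix (Fin n) (Fin n) (Scal R c))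
      (H : Fin n → Fin n → Fin n → Scal R c),
      ∀ {c' : C} (f : c' ⟶ c) (d : (D₂ R n).obj (op c')),
        t.app f d = vres R f a + (mres R f A).mulVec d.1 + bil (cres R f H) d.1 d.1 := by
  rcases Nat.eq_zero_or_pos n with rfl | hn
  · exact ⟨0, 0, 0, fun _ _ => Subsingleton.elim (α := Fin 0 → _) _ _⟩
  · choose a ha using fun k => (hR.second n hn c (t.coordinate k)).exists
    refine ⟨fun k => (a k).1, fun k => (a k).2.1,
      fun k i j => if h : i ≤ j then (a k).2.2 ⟨(i, j), h⟩ else 0, fun f d => funext fun k => ?_⟩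
    refine (ha k f d).trans (congrArg₂ (· + ·) rfl ?_)
    simp only [bil, cres]
    rw [← Fintype.sum_prod_type' (f := fun i j => sres R f (if h : i ≤ j then
      (a k).2.2 ⟨(i, j), h⟩ else 0) * (d.1 i * d.1 j)),
      ← Finset.sum_filter_of_ne (p := fun p : Fin n × Fin n => p.1 ≤ p.2),
      ← Finset.sum_subtype_eq_sum_filter]
    · refine Finset.sum_congr (by simp) fun p _ => ?_
      simp [p.2]
    · intro p _ hp
      by_contra hle
      simp [hle] at hp

end KockLawvere

/-! ### Charts -/

section Chart

variable {J : GrothendieckTopology C} {R : Cᵒᵖ ⥤ CommAlgCat.{w} ℚ} {M : Cᵒᵖ ⥤ Type w} {n : ℕ}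

/-- Restriction of a chart to a later stage. -/
def Chart.pull {c c' : C} (κ : Chart J R M n c) (f : c' ⟶ c) : Chart J R M n c' where
  dom :=
    { carrier := fun g => κ.dom.carrier (g ≫ f)
      restrict := fun g h x hx => by
        rw [Category.assoc]
        exact κ.dom.restrict (g ≫ f) h x hx
      isLocal := fun g x S hS hx => κ.dom.isLocal (g ≫ f) x S hS fun h hh => by
        rw [← Category.assoc]
        exact hx h hh }
  coord g := κ.coord (g ≫ f)
  coord_natural g h x hx := by
    rw [Category.assoc]
    exact κ.coord_natural (g ≫ f) h x hx
  coord_injOn g := κ.coord_injOn (g ≫ f)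
  dom_open := κ.dom_open.pull f
  image_open := κ.image_open.pull f

@[simp] theorem Chart.pull_carrier {c c' c'' : C} (κ : Chart J R M n c) (f : c' ⟶ c) (g : c'' ⟶ c') :
    (κ.pull f).dom.carrier g = κ.dom.carrier (g ≫ f) := rfl

@[simp] theorem Chart.pull_coord {c c' c'' : C} (κ : Chart J R M n c) (f : c' ⟶ c) (g : c'' ⟶ c') :
    (κ.pull f).coord g = κ.coord (g ≫ f) := rfl

theorem Chart.pull_pull {c c' c'' : C} (κ : Chart J R M n c) (f : c' ⟶ c) (g : c'' ⟶ c') :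
    (κ.pull f).pull g = κ.pull (g ≫ f) := by
  simp only [Chart.pull, Category.assoc]

theorem Chart.rst_mem {c c' : C} (κ : Chart J R M n c) {P : M.obj (op c)}
    (hP : P ∈ κ.dom.carrier (𝟙 c)) (f : c' ⟶ c) : rst M f P ∈ κ.dom.carrier f := by
  simpa using κ.dom.restrict (𝟙 c) f P hP

theorem Chart.coord_rst {c c' : C} (κ : Chart J R M n c) {P : M.obj (op c)}
    (hP : P ∈ κ.dom.carrier (𝟙 c)) (f : c' ⟶ c) :
    κ.coord f (rst M f P) = vres R f (κ.coord (𝟙 c) P) := by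
  simpa using κ.coord_natural (𝟙 c) f P hP

/-- Formal openness of the image of the chart, applied to the translation `d ↦ P + d`, whose value
at `0` is in the image. -/
theorem Chart.exists_coord_eq {c c' : C} (κ : Chart J R M n c) {P : M.obj (op c)}
    (hP : P ∈ κ.dom.carrier (𝟙 c)) (f : c' ⟶ c) {d : Fin n → Scal R c'} (hd : InD₂ d) :
    ∃ Q ∈ κ.dom.carrier f, κ.coord f Q = vres R f (κ.coord (𝟙 c) P) + d := by
  let t : StageMap (D₂ R n) (affineSpace R n) c :=
    ⟨fun f d => vres R f (κ.coord (𝟙 c) P) + d.1, fun f g d => by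
      refine (vres_add g _ _).trans ?_
      rw [vres_vres]
      rfl⟩
  have := κ.image_open.second_mem n (𝟙 c) t ⟨P, hP, by
    change _ = vres R (𝟙 c) (κ.coord (𝟙 c) P) + 0
    simp⟩ f ⟨d, hd⟩
  rw [Category.comp_id] at this
  exact this

/-- The point with coordinates `P + d`. -/
noncomputable def Chart.shift {c c' : C} (κ : Chart J R M n c) {P : M.obj (op c)}
    (hP : P ∈ κ.dom.carrier (𝟙 c)) (f : c' ⟶ c) {d : Fin n → Scal R c'} (hd : InD₂ d) :
    M.obj (op c') :=
  (κ.exists_coord_eq hP f hd).choose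

section Shift

variable {c c' : C} (κ : Chart J R M n c) {P : M.obj (op c)} (hP : P ∈ κ.dom.carrier (𝟙 c))
  (f : c' ⟶ c) {d : Fin n → Scal R c'} (hd : InD₂ d)

theorem Chart.shift_mem : κ.shift hP f hd ∈ κ.dom.carrier f :=
  (κ.exists_coord_eq hP f hd).choose_spec.1

theorem Chart.coord_shift : κ.coord f (κ.shift hP f hd) = vres R f (κ.coord (𝟙 c) P) + d :=
  (κ.exists_coord_eq hP f hd).choose_spec.2

theorem Chart.shift_eq {Q : M.obj (op c')} (hQ : Q ∈ κ.dom.carrier f)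
    (h : κ.coord f Q = vres R f (κ.coord (𝟙 c) P) + d) : κ.shift hP f hd = Q :=
  κ.coord_injOn f (κ.shift_mem hP f hd) hQ ((κ.coord_shift hP f hd).trans h.symm)

/-- The point is picked by choice, but injectivity of coordinates determines it, so the choices at
different stages are compatible. -/
theorem Chart.shift_natural {c'' : C} (g : c'' ⟶ c') :
    rst M g (κ.shift hP f hd) = κ.shift hP (g ≫ f) (hd.vres R g) := by
  refine (κ.shift_eq hP _ _ (κ.dom.restrict _ _ _ (κ.shift_mem hP f hd)) ?_).symm
  rw [κ.coord_natural _ _ _ (κ.shift_mem hP f hd), κ.coord_shift, vres_add, vres_vres]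

theorem Chart.shift_zero (h0 : InD₂ (0 : Fin n → Scal R c')) : κ.shift hP f h0 = rst M f P :=
  κ.shift_eq hP f h0 (κ.rst_mem hP f) (by rw [κ.coord_rst hP, add_zero])

end Shift

/-- The map `d ↦ P + d`. -/
noncomputable def Chart.shiftMap {c : C} (κ : Chart J R M n c) {P : M.obj (op c)}
    (hP : P ∈ κ.dom.carrier (𝟙 c)) : StageMap (D₂ R n) M c where
  app f d := κ.shift hP f d.2
  natural f g d := κ.shift_natural hP f d.2 g

/-- Changes of coordinates are quadratic on second-order neighbourhoods. -/
theorem exists_transition (hR : IsKockLawvere J R) {c : C} (κ κ' : Chart J R M n c)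
    {P : M.obj (op c)} (hP : P ∈ κ.dom.carrier (𝟙 c)) (hP' : P ∈ κ'.dom.carrier (𝟙 c)) :
    ∃ (A : Matrix (Fin n) (Fin n) (Scal R c)) (H : Fin n → Fin n → Fin n → Scal R c),
      ∀ {c' : C} (f : c' ⟶ c) (d : Fin n → Scal R c'), InD₂ d → ∀ Q ∈ κ.dom.carrier f,
        κ.coord f Q = vres R f (κ.coord (𝟙 c) P) + d →
        Q ∈ κ'.dom.carrier f ∧ κ'.coord f Q = vres R f (κ'.coord (𝟙 c) P) +
          ((mres R f A).mulVec d + bil (cres R f H) d d) := by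
  -- The second chart contains `P` and is formally open, so it contains the whole
  -- `D₂(n)`-neighbourhood.
  have hmem : ∀ {c' : C} (f : c' ⟶ c) (d : (D₂ R n).obj (op c')),
      κ.shift hP f d.2 ∈ κ'.dom.carrier f := by
    intro c' f d
    have := κ'.dom_open.second_mem n (𝟙 c) (κ.shiftMap hP) (by
      have : (κ.shiftMap hP).app (𝟙 c) (D₂.zero R n c) = P := by
        refine (κ.shift_zero hP (𝟙 c) (D₂.zero R n c).2).trans (rst_id P)
      rwa [this]) f d
    rwa [Category.comp_id] at this
  obtain ⟨a, A, H, h⟩ := hR.exists_quadratic (n := n) (c := c)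
    ⟨fun f d => κ'.coord f (κ.shift hP f d.2), fun f g d => by
      refine (κ'.coord_natural _ _ _ (hmem f d)).symm.trans ?_
      exact congrArg (κ'.coord (g ≫ f)) (κ.shift_natural hP f d.2 g)⟩
  simp only at h
  -- Evaluation at `d = 0` identifies the constant term.
  have ha : a = κ'.coord (𝟙 c) P := by
    have : κ'.coord (𝟙 c) (κ.shift hP (𝟙 c) (D₂.zero R n c).2) =
      vres R (𝟙 c) a + (mres R (𝟙 c) A).mulVec 0 + bil (cres R (𝟙 c) H) 0 0 :=
      h (𝟙 c) (D₂.zero R n c)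
    rw [κ.shift_eq hP (𝟙 c) (D₂.zero R n c).2 hP (by simp)] at this
    simpa [bil_zero_left] using this.symm
  subst ha
  refine ⟨A, H, fun f d hd Q hQ hQd => ?_⟩
  obtain rfl := κ.shift_eq hP f hd hQ hQd
  refine ⟨hmem f ⟨d, hd⟩, ?_⟩
  rw [h f ⟨d, hd⟩, add_assoc]

end Chart

/-! ### Neighbours in charts -/

section Neighbours

variable {J : GrothendieckTopology C} {R : Cᵒᵖ ⥤ CommAlgCat.{w} ℚ} {M : Cᵒᵖ ⥤ Type w} {n : ℕ}

theorem nbr₁_of_coord {c c' : C} (κ : Chart J R M n c) (f : c' ⟶ c) {P Q : M.obj (op c')}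
    (hP : P ∈ κ.dom.carrier f) (hQ : Q ∈ κ.dom.carrier f)
    (h : InD (κ.coord f Q - κ.coord f P)) : Nbr₁ J R M n P Q := by
  refine ⟨⊤, J.top_mem c', fun {c''} g _ => ⟨κ.pull (g ≫ f), ?_, ?_, ?_⟩⟩
  · simpa using κ.dom.restrict f g P hP
  · simpa using κ.dom.restrict f g Q hQ
  · have := h.vres R g
    rw [vres_sub, ← κ.coord_natural f g P hP, ← κ.coord_natural f g Q hQ] at this
    simpa using this

theorem nbr₂_of_coord {c c' : C} (κ : Chart J R M n c) (f : c' ⟶ c) {m : ℕ} {x : Fin m → M.obj (op c')}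
    (hx : ∀ i, x i ∈ κ.dom.carrier f)
    (h : Nbr₂Vec fun i => κ.coord f (x i)) : Nbr₂ J R M n x := by
  refine Or.inr ⟨⊤, J.top_mem c', fun {c''} g _ => ⟨κ.pull (g ≫ f), fun i => ?_, ?_⟩⟩
  · simpa using κ.dom.restrict f g _ (hx i)
  · rw [nbr₂Vec_iff] at h ⊢
    intro i₀ j₀ i₁ j₁ i₂ j₂ a b e
    have := congrArg (sres R g) (h i₀ j₀ i₁ j₁ i₂ j₂ a b e)
    simp only [map_mul, map_sub, map_zero] at this
    simpa [κ.coord_natural f g _ (hx _), vres] using this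

/-- The definition allows different charts on different pieces of a cover; transition maps carry
each of them into `κ`. It then remains to use that the domain of `κ` is local and that `R` is
separated. -/
theorem nbr₁_iff (hR : IsKockLawvere J R) {c : C} (κ : Chart J R M n c) {P Q : M.obj (op c)}
    (hP : P ∈ κ.dom.carrier (𝟙 c)) :
    Nbr₁ J R M n P Q ↔ Q ∈ κ.dom.carrier (𝟙 c) ∧ InD (κ.coord (𝟙 c) Q - κ.coord (𝟙 c) P) := by
  refine ⟨?_, fun h => nbr₁_of_coord κ (𝟙 c) hP h.1 h.2⟩
  rintro ⟨S, hS, h⟩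
  have key : ∀ {c' : C} (f : c' ⟶ c), S f → rst M f Q ∈ κ.dom.carrier f ∧
      InD (κ.coord f (rst M f Q) - κ.coord f (rst M f P)) := by
    intro c' f hf
    obtain ⟨κ', hP', hQ', hD⟩ := h f hf
    obtain ⟨A, H, ht⟩ := exists_transition hR κ' (κ.pull f) hP' (by simpa using κ.rst_mem hP f)
    obtain ⟨h1, h2⟩ := ht (𝟙 c') _ hD.inD₂ _ hQ' (by simp)
    simp only [Chart.pull_carrier, Chart.pull_coord, Category.id_comp, vres_id, mres_id,
      cres_id] at h1 h2
    refine ⟨h1, ?_⟩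
    rw [h2, add_sub_cancel_left]
    -- The difference spans an ideal of square zero, and the new difference has its coordinates in
    -- the same ideal.
    exact VecMem.inD hD.span_mul_span
      (VecMem.mulVec_add_bil A H fun k => Ideal.subset_span ⟨k, rfl⟩)
  have hQ : Q ∈ κ.dom.carrier (𝟙 c) := κ.dom.isLocal _ _ S hS fun f hf => by
    simpa using (key f hf).1
  refine ⟨hQ, fun i j => hR.eq_of_locally_eq hS fun f hf => ?_⟩
  have := (key f hf).2 i j
  rw [κ.coord_rst hP, κ.coord_rst hQ] at this
  simpa [vres] using this

/-- Any chart containing `P` tests second-order neighbours of `P`: locally they move into `κ` by a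
quadratic transition map, which keeps the ideal of vanishing cube. The vanishing of triple products
is local, whereas the ideal is rebuilt from them at stage `c`. -/
theorem nbr₂_cons_iff (hR : IsKockLawvere J R) {c : C} (κ : Chart J R M n c) {P : M.obj (op c)}
    (hP : P ∈ κ.dom.carrier (𝟙 c)) {m : ℕ} (x : Fin m → M.obj (op c)) :
    Nbr₂ J R M n (Matrix.vecCons P x) ↔ (∀ i, x i ∈ κ.dom.carrier (𝟙 c)) ∧
      ∃ I : Ideal (Scal R c), I * I * I = ⊥ ∧
        ∀ i, VecMem I (κ.coord (𝟙 c) (x i) - κ.coord (𝟙 c) P) := by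
  have hcons : ∀ {c' : C} (k : M.obj (op c) → Fin n → Scal R c'),
      (fun i => k (Matrix.vecCons P x i)) = Matrix.vecCons (k P) (fun i => k (x i)) := by
    intro c' k
    funext i
    refine Fin.cases ?_ (fun i => ?_) i <;> simp
  rw [← nbr₂Vec_cons_iff, ← hcons (κ.coord (𝟙 c))]
  constructor
  swap
  · rintro ⟨h1, h2⟩
    exact nbr₂_of_coord κ (𝟙 c) (fun i => Fin.cases (by simpa) (fun i => by simpa using h1 i) i) h2
  rintro (h | ⟨S, hS, h⟩)
  · exact absurd h (Nat.succ_ne_zero m)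
  have key : ∀ {c' : C} (f : c' ⟶ c), S f → (∀ i, rst M f (x i) ∈ κ.dom.carrier f) ∧
      Nbr₂Vec fun i => κ.coord f (rst M f (Matrix.vecCons P x i)) := by
    intro c' f hf
    obtain ⟨κ', hx', hV⟩ := h f hf
    rw [hcons fun y => κ'.coord (𝟙 c') (rst M f y), nbr₂Vec_cons_iff] at hV
    obtain ⟨I, hI, hV⟩ := hV
    have hP' : rst M f P ∈ κ'.dom.carrier (𝟙 c') := by simpa using hx' 0
    obtain ⟨A, H, ht⟩ := exists_transition hR κ' (κ.pull f) hP' (by simpa using κ.rst_mem hP f)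
    have h1 := fun i => ht (𝟙 c') _ ((hV i).inD₂ hI) (rst M f (x i)) (by simpa using hx' i.succ)
      (by simp)
    simp only [Chart.pull_carrier, Chart.pull_coord, Category.id_comp, vres_id, mres_id,
      cres_id] at h1
    refine ⟨fun i => (h1 i).1, ?_⟩
    rw [hcons fun y => κ.coord f (rst M f y), nbr₂Vec_cons_iff]
    refine ⟨I, hI, fun i => ?_⟩
    rw [(h1 i).2, add_sub_cancel_left]
    exact VecMem.mulVec_add_bil A H (hV i)
  have hx : ∀ i, x i ∈ κ.dom.carrier (𝟙 c) := fun i => κ.dom.isLocal _ _ S hS fun f hf => by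
    simpa using (key f hf).1 i
  have hx' : ∀ i, Matrix.vecCons P x i ∈ κ.dom.carrier (𝟙 c) :=
    fun i => Fin.cases (by simpa) (fun i => by simpa using hx i) i
  refine ⟨hx, ?_⟩
  rw [nbr₂Vec_iff]
  intro i₀ j₀ i₁ j₁ i₂ j₂ a b e
  refine hR.eq_of_locally_eq hS fun f hf => ?_
  have := (nbr₂Vec_iff _).1 (key f hf).2 i₀ j₀ i₁ j₁ i₂ j₂ a b e
  simp only [κ.coord_rst (hx' _)] at this
  simpa [vres] using this

end Neighbours

/-! ### The symbol of an affine connection -/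

section Symbol

variable {J : GrothendieckTopology C} {R : Cᵒᵖ ⥤ CommAlgCat.{w} ℚ} {M : Cᵒᵖ ⥤ Type w} {n : ℕ}

theorem Chart.pull_id {c : C} (κ : Chart J R M n c) : κ.pull (𝟙 c) = κ := by
  obtain ⟨⟨_, _, _⟩, _, _, _, _, _⟩ := κ
  simp only [Chart.pull, Category.comp_id]

theorem Nbr₁.restrict {c c' : C} (f : c' ⟶ c) {P Q : M.obj (op c)} (h : Nbr₁ J R M n P Q) :
    Nbr₁ J R M n (rst M f P) (rst M f Q) := by
  obtain ⟨S, hS, h⟩ := h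
  refine ⟨S.pullback f, J.pullback_stable f hS, fun {c''} g hg => ?_⟩
  simpa only [rst_rst] using h (g ≫ f) hg

theorem Nbr₁.mem_coord (hR : IsKockLawvere J R) {c c' : C} (κ : Chart J R M n c) {f : c' ⟶ c}
    {P Q : M.obj (op c')} (h : Nbr₁ J R M n P Q) (hP : P ∈ κ.dom.carrier f) :
    Q ∈ κ.dom.carrier f ∧ InD (κ.coord f Q - κ.coord f P) := by
  simpa using (nbr₁_iff hR (κ.pull f) (by simpa using hP)).1 h

theorem nbr₁_shift {c c' : C} (κ : Chart J R M n c) {P : M.obj (op c)}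
    (hP : P ∈ κ.dom.carrier (𝟙 c)) (f : c' ⟶ c) {d : Fin n → Scal R c'} (hd : InD d) :
    Nbr₁ J R M n (rst M f P) (κ.shift hP f hd.inD₂) :=
  nbr₁_of_coord κ f (κ.rst_mem hP f) (κ.shift_mem hP f _) (by
    rwa [κ.coord_shift, κ.coord_rst hP, add_sub_cancel_left])

namespace AffineConnection

variable (lam : AffineConnection J R M n)

theorem op_congr {c : C} {P P' Q Q' S S' : M.obj (.op c)} (eP : P = P') (eQ : Q = Q') (eS : S = S')
    (hQ : Nbr₁ J R M n P Q) (hS : Nbr₁ J R M n P S) (hQ' : Nbr₁ J R M n P' Q')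
    (hS' : Nbr₁ J R M n P' S') : lam.op P Q S hQ hS = lam.op P' Q' S' hQ' hS' := by
  subst eP eQ eS
  rfl

/-- `A` is the linear part of `S ↦ λ(P, Q, S)` in the chart `κ`. -/
def IsSlope {c : C} (κ : Chart J R M n c) (P Q : M.obj (.op c))
    (A : Matrix (Fin n) (Fin n) (Scal R c)) : Prop :=
  ∀ {c' : C} (f : c' ⟶ c) (S : M.obj (.op c')) (hQ : Nbr₁ J R M n (rst M f P) (rst M f Q))
    (hS : Nbr₁ J R M n (rst M f P) S),
    lam.op (rst M f P) (rst M f Q) S hQ hS ∈ κ.dom.carrier f ∧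
    κ.coord f (lam.op (rst M f P) (rst M f Q) S hQ hS) = κ.coord f (rst M f Q) +
      (mres R f A).mulVec (κ.coord f S - κ.coord f (rst M f P))

/-- For fixed `Q` the map `d ↦ λ(P, Q, P + d)` starts at `Q`, hence stays in the chart by formal
openness and is affine by the Kock-Lawvere axiom. -/
theorem exists_slope (hR : IsKockLawvere J R) {c : C} (κ : Chart J R M n c) {P Q : M.obj (.op c)}
    (hP : P ∈ κ.dom.carrier (𝟙 c)) (hPQ : Nbr₁ J R M n P Q) : ∃ A, lam.IsSlope κ P Q A := by
  have hQ := (hPQ.mem_coord hR κ hP).1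
  let t : StageMap (D R n) M c :=
    ⟨fun f d => lam.op (rst M f P) (rst M f Q) (κ.shift hP f d.2.inD₂) (hPQ.restrict f)
        (nbr₁_shift κ hP f d.2), fun {c' c''} f g d => by
      refine (lam.natural g _ _ _ _ _ ((hPQ.restrict f).restrict g)
        ((nbr₁_shift κ hP f d.2).restrict g)).trans ?_
      exact lam.op_congr (rst_rst f g P) (rst_rst f g Q) (κ.shift_natural hP f d.2.inD₂ g)
        _ _ _ _⟩
  -- The law `λ(P, Q, P) = Q` gives the base value, and below the constant term.
  have ht0 : ∀ {c' : C} (f : c' ⟶ c), t.app f (D.zero R n c') = rst M f Q := fun {c'} f =>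
    (lam.op_congr rfl rfl (κ.shift_zero hP f (D.zero R n c').2.inD₂) _ _ (hPQ.restrict f)
      (nbr₁_of_coord κ f (κ.rst_mem hP f) (κ.rst_mem hP f) (by simp [InD]))).trans
      (lam.op_right _ _ _ _)
  have hmem : ∀ {c' : C} (f : c' ⟶ c) (d : (D R n).obj (.op c')), t.app f d ∈ κ.dom.carrier f := by
    intro c' f d
    have := κ.dom_open.first_mem n (𝟙 c) t (by rwa [ht0, rst_id]) f d
    rwa [Category.comp_id] at this
  obtain ⟨a, A, h⟩ := hR.exists_affine (n := n) (c := c)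
    ⟨fun f d => κ.coord f (t.app f d), fun f g d => by
      rw [← t.natural]
      exact (κ.coord_natural _ _ _ (hmem f d)).symm⟩
  have ha : ∀ {c' : C} (f : c' ⟶ c), vres R f a = κ.coord f (rst M f Q) := by
    intro c' f
    have : κ.coord f (t.app f (D.zero R n c')) = vres R f a + (mres R f A).mulVec 0 :=
      h f (D.zero R n c')
    rw [ht0, Matrix.mulVec_zero, add_zero] at this
    exact this.symm
  refine ⟨A, fun {c'} f S hQ hS => ?_⟩
  obtain ⟨hSm, hSd⟩ := hS.mem_coord hR κ (κ.rst_mem hP f)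
  have e : κ.shift hP f hSd.inD₂ = S := κ.shift_eq hP f _ hSm (by
    rw [κ.coord_rst hP, add_sub_cancel])
  have e' : t.app f ⟨_, hSd⟩ = lam.op (rst M f P) (rst M f Q) S hQ hS :=
    lam.op_congr rfl rfl e _ _ _ _
  rw [← e', ← ha]
  exact ⟨hmem f ⟨_, hSd⟩, h f ⟨_, hSd⟩⟩

variable {lam}

theorem IsSlope.pull {c c' : C} {κ : Chart J R M n c} {P Q : M.obj (.op c)}
    {A : Matrix (Fin n) (Fin n) (Scal R c)} (h : lam.IsSlope κ P Q A) (f : c' ⟶ c) :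
    lam.IsSlope (κ.pull f) (rst M f P) (rst M f Q) (mres R f A) := by
  intro c'' g S
  rw [rst_rst, rst_rst, mres_mres]
  exact h (g ≫ f) S

/-- Uniqueness makes the slopes chosen at different stages compatible, so that the axiom can be
applied to the slope as a function of `Q`. -/
theorem IsSlope.unique (hR : IsKockLawvere J R) {c : C} {κ : Chart J R M n c} {P Q : M.obj (.op c)}
    (hP : P ∈ κ.dom.carrier (𝟙 c)) (hPQ : Nbr₁ J R M n P Q)
    {A A' : Matrix (Fin n) (Fin n) (Scal R c)} (h : lam.IsSlope κ P Q A)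
    (h' : lam.IsSlope κ P Q A') : A = A' := by
  refine hR.matrix_ext fun f d hd => ?_
  have e := (h f _ (hPQ.restrict f) (nbr₁_shift κ hP f hd)).2
  rw [(h' f _ (hPQ.restrict f) (nbr₁_shift κ hP f hd)).2, κ.coord_shift, κ.coord_rst hP,
    add_sub_cancel_left] at e
  exact (add_left_cancel e).symm

variable (lam)

/-- The slope of `S ↦ λ(P, Q, S)` is itself affine in `Q`. Its constant part acts as the identity on
`S - P` because `λ(P, P, S) = S`, and its linear part is the symbol. -/
theorem exists_symbol (hR : IsKockLawvere J R) {c : C} (κ : Chart J R M n c) {P : M.obj (.op c)}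
    (hP : P ∈ κ.dom.carrier (𝟙 c)) : ∃ Γ, lam.IsSymbol κ P Γ := by
  have hPf : ∀ {c' : C} (f : c' ⟶ c), rst M f P ∈ (κ.pull f).dom.carrier (𝟙 c') := by
    intro c' f
    simpa using κ.rst_mem hP f
  have hex : ∀ {c' : C} (f : c' ⟶ c) (d : (D R n).obj (.op c')),
      ∃ A, lam.IsSlope (κ.pull f) (rst M f P) (κ.shift hP f d.2.inD₂) A :=
    fun f d => lam.exists_slope hR (κ.pull f) (hPf f) (nbr₁_shift κ hP f d.2)
  choose σ hσ using @hex
  have hσn : ∀ {c' c'' : C} (f : c' ⟶ c) (g : c'' ⟶ c') (d : (D R n).obj (.op c')),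
      mres R g (σ f d) = σ (g ≫ f) (rst (D R n) g d) := by
    intro c' c'' f g d
    refine IsSlope.unique hR (hPf (g ≫ f)) (nbr₁_shift κ hP (g ≫ f) (rst (D R n) g d).2)
      ?_ (hσ (g ≫ f) (rst (D R n) g d))
    have : lam.IsSlope ((κ.pull f).pull g) (rst M g (rst M f P))
      (rst M g (κ.shift hP f d.2.inD₂)) (mres R g (σ f d)) := IsSlope.pull (hσ f d) g
    rwa [κ.pull_pull, rst_rst, κ.shift_natural] at this
  -- The slope is expanded column by column: `Γ j k i` is the coefficient of `dᵢ` in the entry of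
  -- row `k` and column `j`.
  choose b Γ hΓ using fun j => hR.exists_affine (n := n) (c := c)
    ⟨fun f d k => σ f d k j, fun f g d => by
      rw [← hσn]
      rfl⟩
  refine ⟨fun k i j => Γ j k i, fun {c'} f Q S hQ hS => ?_⟩
  obtain ⟨hQm, hQd⟩ := hQ.mem_coord hR κ (κ.rst_mem hP f)
  obtain ⟨hSm, hSd⟩ := hS.mem_coord hR κ (κ.rst_mem hP f)
  have key : ∀ (Q : M.obj (.op c')) (hQ : Nbr₁ J R M n (rst M f P) Q) (d : Fin n → Scal R c')
      (hd : InD d), Q ∈ κ.dom.carrier f → κ.coord f Q = vres R f (κ.coord (𝟙 c) P) + d →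
      lam.op (rst M f P) Q S hQ hS ∈ κ.dom.carrier f ∧
      κ.coord f (lam.op (rst M f P) Q S hQ hS) = κ.coord f Q +
        ((fun k => ∑ j, sres R f (b j k) * (κ.coord f S - κ.coord f (rst M f P)) j) +
          bil (cres R f fun k i j => Γ j k i) d (κ.coord f S - κ.coord f (rst M f P))) := by
    intro Q hQ d hd hQm hQd
    have e := κ.shift_eq hP f hd.inD₂ hQm hQd
    have h1 := hσ f ⟨d, hd⟩ (𝟙 c') S
    simp only [rst_id, e, Chart.pull_carrier, Chart.pull_coord, Category.id_comp, mres_id] at h1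
    refine ⟨(h1 hQ hS).1, (h1 hQ hS).2.trans (congrArg _ ?_)⟩
    funext k
    have h2 : ∀ j, σ f ⟨d, hd⟩ k j = sres R f (b j k) + ∑ i, sres R f (Γ j k i) * d i :=
      fun j => congrFun (hΓ j f ⟨d, hd⟩) k
    simp only [Matrix.mulVec, dotProduct, Pi.add_apply, h2, bil, cres, add_mul,
      Finset.sum_add_distrib, Finset.sum_mul]
    rw [Finset.sum_comm]
    simp only [mul_assoc]
  -- The case `Q = P`. It determines how `b` acts on `S - P`, which is all that is needed of `b`.
  have h0 := (key (rst M f P) (nbr₁_of_coord κ f (κ.rst_mem hP f) (κ.rst_mem hP f)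
    (by simp [InD])) 0 (by simp [InD]) (κ.rst_mem hP f) (by rw [κ.coord_rst hP, add_zero])).2
  rw [lam.op_left, bil_zero_left, add_zero] at h0
  have h1 := key Q hQ _ hQd hQm (by rw [κ.coord_rst hP, add_sub_cancel])
  rw [← sub_eq_iff_eq_add'.2 h0, ← add_assoc, ← add_sub_assoc] at h1
  exact ⟨hQm, hSm, h1⟩

variable {lam}

theorem IsSymbol.pull {c c' : C} {κ : Chart J R M n c} {P : M.obj (.op c)}
    {Γ : Fin n → Fin n → Fin n → Scal R c} (h : lam.IsSymbol κ P Γ) (f : c' ⟶ c) :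
    lam.IsSymbol (κ.pull f) (rst M f P) (cres R f Γ) := by
  intro c'' g Q S
  rw [rst_rst, cres_cres]
  exact h (g ≫ f) Q S

theorem IsSymbol.unique (hR : IsKockLawvere J R) {c : C} {κ : Chart J R M n c} {P : M.obj (.op c)}
    (hP : P ∈ κ.dom.carrier (𝟙 c)) {Γ Γ' : Fin n → Fin n → Fin n → Scal R c}
    (h : lam.IsSymbol κ P Γ) (h' : lam.IsSymbol κ P Γ') : Γ = Γ' := by
  refine hR.bil_ext fun f d e hd he => ?_
  have e1 := (h f _ _ (nbr₁_shift κ hP f hd) (nbr₁_shift κ hP f he)).2.2.2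
  rw [(h' f _ _ (nbr₁_shift κ hP f hd) (nbr₁_shift κ hP f he)).2.2.2, κ.coord_shift, κ.coord_shift,
    κ.coord_rst hP, add_sub_cancel_left, add_sub_cancel_left] at e1
  exact (add_left_cancel e1).symm

/-- The symbols at second-order neighbours differ by terms of first order. -/
theorem IsSymbol.sub_mem (hR : IsKockLawvere J R) {c : C} {κ : Chart J R M n c} {P Q : M.obj (.op c)}
    (hP : P ∈ κ.dom.carrier (𝟙 c)) (hQ : Q ∈ κ.dom.carrier (𝟙 c))
    {Γ Γ' : Fin n → Fin n → Fin n → Scal R c}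
    (h : lam.IsSymbol κ P Γ) (h' : lam.IsSymbol κ Q Γ')
    (hPQ : InD₂ (κ.coord (𝟙 c) Q - κ.coord (𝟙 c) P)) {I : Ideal (Scal R c)}
    (hI : VecMem I (κ.coord (𝟙 c) Q - κ.coord (𝟙 c) P)) (k i j : Fin n) :
    Γ' k i j - Γ k i j ∈ I := by
  have hmem : ∀ {c' : C} (f : c' ⟶ c) (d : (D₂ R n).obj (.op c')),
      κ.shift hP f d.2 ∈ (κ.pull f).dom.carrier (𝟙 c') := by
    intro c' f d
    simpa using κ.shift_mem hP f d.2
  have hex : ∀ {c' : C} (f : c' ⟶ c) (d : (D₂ R n).obj (.op c')),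
      ∃ Γ, lam.IsSymbol (κ.pull f) (κ.shift hP f d.2) Γ :=
    fun f d => lam.exists_symbol hR (κ.pull f) (hmem f d)
  -- Both symbols become values of one map on `D₂(n)`, natural by uniqueness of symbols. For fixed
  -- `i`, `j` it is quadratic, so its increment from `0` lies in `I`.
  choose G hG using @hex
  have hGn : ∀ {c' c'' : C} (f : c' ⟶ c) (g : c'' ⟶ c') (d : (D₂ R n).obj (.op c')),
      cres R g (G f d) = G (g ≫ f) (rst (D₂ R n) g d) := by
    intro c' c'' f g d
    refine IsSymbol.unique hR (hmem (g ≫ f) (rst (D₂ R n) g d)) ?_ (hG (g ≫ f) _)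
    have : lam.IsSymbol ((κ.pull f).pull g) (rst M g (κ.shift hP f d.2))
      (cres R g (G f d)) := IsSymbol.pull (hG f d) g
    rwa [κ.pull_pull, κ.shift_natural] at this
  obtain ⟨a, A, H, hA⟩ := hR.exists_quadratic (n := n) (c := c)
    ⟨fun f d k => G f d k i j, fun f g d => by
      rw [← hGn]
      rfl⟩
  have hA' : ∀ d : (D₂ R n).obj (.op c), (fun k => G (𝟙 c) d k i j) =
      a + (A.mulVec d.1 + bil H d.1 d.1) := by
    intro d
    have : (fun k => G (𝟙 c) d k i j) =
      vres R (𝟙 c) a + (mres R (𝟙 c) A).mulVec d.1 + bil (cres R (𝟙 c) H) d.1 d.1 := hA (𝟙 c) d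
    simpa [add_assoc] using this
  have e : ∀ (d : (D₂ R n).obj (.op c)) (Q : M.obj (.op c)) (Γ' : Fin n → Fin n → Fin n → Scal R c),
      Q ∈ κ.dom.carrier (𝟙 c) → lam.IsSymbol κ Q Γ' →
      κ.coord (𝟙 c) Q = vres R (𝟙 c) (κ.coord (𝟙 c) P) + d.1 → G (𝟙 c) d = Γ' := by
    intro d Q Γ' hQ h' hd
    refine IsSymbol.unique hR hQ ?_ h'
    have : lam.IsSymbol (κ.pull (𝟙 c)) (κ.shift hP (𝟙 c) d.2) (G (𝟙 c) d) := hG (𝟙 c) d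
    rwa [κ.pull_id, κ.shift_eq hP (𝟙 c) _ hQ hd] at this
  have e0 : G (𝟙 c) (D₂.zero R n c) = Γ := e _ P Γ hP h (by simp)
  have e1 : G (𝟙 c) ⟨_, hPQ⟩ = Γ' := e _ Q Γ' hQ h' (by simp)
  have h0 := hA' (D₂.zero R n c)
  have h1 := congrFun (hA' ⟨_, hPQ⟩) k
  rw [D₂.zero_val, Matrix.mulVec_zero, bil_zero_left, add_zero, add_zero, e0] at h0
  rw [← h0, e1] at h1
  rw [sub_eq_iff_eq_add'.2 h1]
  exact VecMem.mulVec_add_bil A H hI k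

/-- The transformation law of connection symbols. -/
theorem IsSymbol.transform (hR : IsKockLawvere J R) {c : C} {κ κ' : Chart J R M n c}
    {P : M.obj (.op c)} (hP : P ∈ κ.dom.carrier (𝟙 c)) (hP' : P ∈ κ'.dom.carrier (𝟙 c))
    {Γ Γ' : Fin n → Fin n → Fin n → Scal R c} (h : lam.IsSymbol κ P Γ) (h' : lam.IsSymbol κ' P Γ')
    {A : Matrix (Fin n) (Fin n) (Scal R c)} {H : Fin n → Fin n → Fin n → Scal R c}
    (ht : ∀ {c' : C} (f : c' ⟶ c) (d : Fin n → Scal R c'), InD₂ d → ∀ Q ∈ κ.dom.carrier f,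
        κ.coord f Q = vres R f (κ.coord (𝟙 c) P) + d →
        Q ∈ κ'.dom.carrier f ∧ κ'.coord f Q = vres R f (κ'.coord (𝟙 c) P) +
          ((mres R f A).mulVec d + bil (cres R f H) d d)) (x y : Fin n → Scal R c) :
    A.mulVec (bil Γ x y) + bil H x y + bil H y x = bil Γ' (A.mulVec x) (A.mulVec y) := by
  -- With both sides written as coefficient arrays, `bil_ext` reduces the law to first-order
  -- arguments, where `λ` can be evaluated.
  have coeff : ∀ {S : Type w} [CommRing S] (A : Matrix (Fin n) (Fin n) S)
      (H Γ : Fin n → Fin n → Fin n → S) (x y : Fin n → S),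
      A.mulVec (bil Γ x y) + bil H x y + bil H y x =
        bil (fun k i j => (∑ l, A k l * Γ l i j + H k i j) + H k j i) x y := by
    intro S _ A H Γ x y
    rw [bil_add_coeff (fun k i j => ∑ l, A k l * Γ l i j + H k i j) (fun k i j => H k j i),
      bil_add_coeff (fun k i j => ∑ l, A k l * Γ l i j) H, mulVec_bil, bil_swap_coeff H]
  rw [coeff, bil_mulVec]
  congr 1
  refine hR.bil_ext fun {c'} f d e hd he => ?_
  have r1 : cres R f (fun k i j => (∑ l, A k l * Γ l i j + H k i j) + H k j i) =
      fun k i j => (∑ l, mres R f A k l * cres R f Γ l i j + cres R f H k i j) +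
        cres R f H k j i := by
    funext k i j
    simp [cres, mres]
  have r2 : cres R f (fun k i j => ∑ a, ∑ b, Γ' k a b * (A a i * A b j)) =
      fun k i j => ∑ a, ∑ b, cres R f Γ' k a b * (mres R f A a i * mres R f A b j) := by
    funext k i j
    simp [cres, mres]
  rw [r1, r2, ← coeff, ← bil_mulVec]
  set A' := mres R f A
  set H' := cres R f H
  have hd' : bil H' d d = 0 := bil_eq_zero _ hd
  have he' : bil H' e e = 0 := bil_eq_zero _ he
  have hQ := nbr₁_shift κ hP f hd
  have hS := nbr₁_shift κ hP f he
  obtain ⟨-, -, hT, hTc⟩ := h f _ _ hQ hS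
  obtain ⟨-, -, hT', hTc'⟩ := h' f _ _ hQ hS
  have q1 := (ht f d hd.inD₂ _ (κ.shift_mem hP f hd.inD₂) (κ.coord_shift hP f hd.inD₂)).2
  have q2 := (ht f e he.inD₂ _ (κ.shift_mem hP f he.inD₂) (κ.coord_shift hP f he.inD₂)).2
  rw [κ.coord_shift, κ.coord_shift, κ.coord_rst hP, add_sub_cancel_left, add_sub_cancel_left] at hTc
  rw [q1, q2, κ'.coord_rst hP', add_sub_cancel_left, add_sub_cancel_left, hd', he', add_zero,
    add_zero] at hTc'
  -- The point `λ(P, P + d, P + e)` is only a second-order neighbour of `P`; the transition formula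
  -- applies to it through this ideal. Comparing with the symbol in `κ'` isolates the bilinear
  -- terms.
  obtain ⟨I, hcube, hdI, heI⟩ := hd.exists_cube_zero he
  have hu := hdI.bil (cres R f Γ) heI
  have hsum := (hdI.add heI).add (hu.mono Ideal.mul_le_right)
  have hTt := (ht f _ (hsum.inD₂ hcube) _ hT (by rw [hTc]; abel)).2
  rw [hTc', bil_perturb hcube H' (hdI.add heI) (hdI.add heI) hu hu] at hTt
  simp only [Matrix.mulVec_add, bil_add_left, bil_add_right, hd', he', zero_add, add_zero] at hTt
  have e1 : ∀ p a b g z : Fin n → Scal R c', p + a + (p + b) - p + g = p + (a + b + z) → z = g := by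
    intro p a b g z hz
    have : z - g = 0 := by
      rw [← sub_eq_zero.2 hz.symm]
      abel
    exact sub_eq_zero.1 this
  refine e1 _ _ _ _ _ (hTt.trans ?_)
  abel

/-- The bracket of the tangent space given by minus the torsion. -/
theorem IsSymbol.isTorsionBracket (hR : IsKockLawvere J R) {c : C} {κ : Chart J R M n c}
    {P : M.obj (.op c)} (hP : P ∈ κ.dom.carrier (𝟙 c)) {Γ : Fin n → Fin n → Fin n → Scal R c}
    (h : lam.IsSymbol κ P Γ) : lam.IsTorsionBracket κ P (fun k i j => Γ k i j - Γ k j i) := by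
  intro c' f v₁ v₂ d₁ d₂ h₁ h₂
  have inD_smul : ∀ {d : Scal R c'} (v : Fin n → Scal R c'), d * d = 0 → InD (d • v) := by
    intro d v hd i j
    simp only [Pi.smul_apply, smul_eq_mul]
    linear_combination (v i * v j) * hd
  have hd₁ := inD_smul v₁ h₁
  have hd₂ := inD_smul v₂ h₂
  have hQ := nbr₁_shift κ hP f hd₁
  have hS := nbr₁_shift κ hP f hd₂
  obtain ⟨hQm, hSm, hU, hUc⟩ := h f _ _ hQ hS
  have hQc := κ.coord_shift hP f hd₁.inD₂
  have hSc := κ.coord_shift hP f hd₂.inD₂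
  set Q := κ.shift hP f hd₁.inD₂
  set S := κ.shift hP f hd₂.inD₂
  set U := lam.op (rst M f P) Q S hQ hS with hUdef
  set p := κ.coord f (rst M f P) with hp
  set Γf := cres R f Γ with hΓf
  rw [← κ.coord_rst hP, ← hp] at hQc hSc
  rw [hQc, hSc, add_sub_cancel_left, add_sub_cancel_left, bil_smul_left, bil_smul_right,
    smul_smul] at hUc
  -- Seen from `U` the roles swap: `Q - U` is a multiple of `d₂` and `S - U` of `d₁`. Hence both are
  -- first-order neighbours of `U`, and `Γ'` below gets its arguments in the order `v₂`, `v₁`.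
  have eQ : κ.coord f Q - κ.coord f U = d₂ • -(v₂ + d₁ • bil Γf v₁ v₂) := by
    rw [hQc, hUc]
    module
  have eS : κ.coord f S - κ.coord f U = d₁ • -(v₁ + d₂ • bil Γf v₁ v₂) := by
    rw [hSc, hUc]
    module
  have hUQ : Nbr₁ J R M n U Q := nbr₁_of_coord κ f hU hQm (by rw [eQ]; exact inD_smul _ h₂)
  have hUS : Nbr₁ J R M n U S := nbr₁_of_coord κ f hU hSm (by rw [eS]; exact inD_smul _ h₁)
  obtain ⟨Γ', hΓ'⟩ := lam.exists_symbol hR (κ.pull f) (P := U) (by simpa using hU)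
  have hT := hΓ' (𝟙 c') Q S (by rwa [rst_id]) (by rwa [rst_id])
  simp only [rst_id, Chart.pull_carrier, Chart.pull_coord, Category.id_comp, cres_id] at hT
  obtain ⟨-, -, hTm, hTc⟩ := hT
  refine ⟨Q, hQm, S, hSm, _, hTm, hQc, hSc, ⟨hQ, hS, hUQ, hUS, rfl⟩, ?_⟩
  -- The difference of the symbols at `U` and `P` has the form `a d₁ + b d₂`, so multiplication by
  -- `d₁ d₂` produces a square in each term.
  have hdiff : ∀ k i j, d₁ * d₂ * Γ' k i j = d₁ * d₂ * Γf k i j := by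
    intro k i j
    have e : κ.coord f U - p = d₁ • v₁ + d₂ • (v₂ + d₁ • bil Γf v₁ v₂) := by
      rw [hUc]
      module
    have hmem := IsSymbol.sub_mem hR (κ := κ.pull f) (P := rst M f P) (Q := U)
      (by simpa using κ.rst_mem hP f) (by simpa using hU) (h.pull f) hΓ'
      (I := Ideal.span {d₁, d₂}) (by
        simp only [Chart.pull_coord, Category.id_comp, ← hp, e]
        intro a b c
        simp only [Pi.add_apply, Pi.smul_apply, smul_eq_mul]
        generalize v₁ a = x1
        generalize v₁ b = x2
        generalize v₁ c = x3
        generalize v₂ a + _ = y1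
        generalize v₂ b + _ = y2
        generalize v₂ c + _ = y3
        -- Every cubic monomial in `d₁` and `d₂` contains `d₁²` or `d₂²`.
        linear_combination (x1 * x2 * (d₁ * x3 + d₂ * y3) + (x1 * y2 + y1 * x2) * d₂ * x3) * h₁ +
          ((x1 * y2 + y1 * x2) * d₁ * y3 + y1 * y2 * (d₁ * x3 + d₂ * y3)) * h₂) (by
        simp only [Chart.pull_coord, Category.id_comp, ← hp, e]
        intro a
        simp only [Pi.add_apply, Pi.smul_apply, smul_eq_mul]
        exact Ideal.add_mem _ (Ideal.mul_mem_right _ _ (Ideal.subset_span (by simp)))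
          (Ideal.mul_mem_right _ _ (Ideal.subset_span (by simp)))) k i j
    obtain ⟨a, b, hab⟩ := Ideal.mem_span_pair.1 hmem
    change _ = Γ' k i j - Γf k i j at hab
    linear_combination -(d₁ * d₂) * hab + a * d₂ * h₁ + b * d₁ * h₂
  have hbil : (d₁ * d₂) • bil Γ' v₂ v₁ = (d₁ * d₂) • bil Γf v₂ v₁ := by
    funext k
    simp only [bil, Pi.smul_apply, smul_eq_mul, Finset.mul_sum, ← mul_assoc, hdiff]
  have hlast : bil Γ' (κ.coord f Q - κ.coord f U) (κ.coord f S - κ.coord f U) =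
      (d₁ * d₂) • bil Γ' v₂ v₁ := by
    rw [eQ, eS, bil_smul_left, bil_smul_right, bil_neg_left, bil_neg_right, neg_neg, bil_add_left,
      bil_add_right, bil_add_right, bil_smul_left, bil_smul_right]
    funext k
    simp only [bil_smul_left, bil_smul_right, Pi.smul_apply, Pi.add_apply, smul_eq_mul]
    generalize bil Γ' v₂ v₁ k = x
    generalize bil Γ' v₂ (bil Γf v₁ v₂) k = y
    generalize bil Γ' (bil Γf v₁ v₂) v₁ k = z
    generalize bil Γ' (bil Γf v₁ v₂) (bil Γf v₁ v₂) k = t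
    linear_combination (d₂ * z + d₂ * d₂ * t) * h₁ + d₁ * y * h₂
  have hB : bil (cres R f fun k i j => Γ k i j - Γ k j i) v₁ v₂ = bil Γf v₁ v₂ - bil Γf v₂ v₁ := by
    have : cres R f (fun k i j => Γ k i j - Γ k j i) = fun k i j => Γf k i j - Γf k j i := by
      funext k i j
      simp [hΓf, cres]
    rw [this, bil_sub_coeff, bil_swap_coeff Γf v₁ v₂]
  rw [hTc, hlast, hbil, hB, hQc, hSc, hUc]
  module

end AffineConnection

end Symbol

section Product

variable {J : GrothendieckTopology C} {R : Cᵒᵖ ⥤ CommAlgCat.{w} ℚ} {M : Cᵒᵖ ⥤ Type w} {n : ℕ}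

/-! ### Neighbours of second order -/

theorem map_vecCons {α β : Type*} {m : ℕ} (k : α → β) (a : α) (x : Fin m → α) :
    (fun i => k (Matrix.vecCons a x i)) = Matrix.vecCons (k a) (fun i => k (x i)) :=
  funext fun i => Fin.cases rfl (fun _ => rfl) i

theorem map_pair {α β : Type*} (k : α → β) (a b : α) :
    (fun i => k (![a, b] i)) = ![k a, k b] := by
  funext i
  fin_cases i <;> rfl

theorem map_triple {α β : Type*} (k : α → β) (a b c : α) :
    (fun i => k (![a, b, c] i)) = ![k a, k b, k c] := by
  funext i
  fin_cases i <;> rfl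

theorem nbr₂_restrict (hM : IsFormalManifold J R M n) {c c' : C} (f : c' ⟶ c) {m : ℕ}
    {x : Fin m → M.obj (op c)} (h : Nbr₂ J R M n x) : Nbr₂ J R M n fun i => rst M f (x i) :=
  (secondOrder hM).restrict f x h

theorem nbr₂_reindex (hM : IsFormalManifold J R M n) {c : C} {m k : ℕ} (h : Fin m → Fin k)
    {x : Fin k → M.obj (op c)} (hx : Nbr₂ J R M n x) : Nbr₂ J R M n (x ∘ h) :=
  (secondOrder hM).reindex h x hx

theorem eq_of_charts (hM : IsFormalManifold J R M n) {c : C} (P : M.obj (op c)) {T T' : M.obj (op c)}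
    (h : ∀ {c' : C} (f : c' ⟶ c) (κ : Chart J R M n c'), rst M f P ∈ κ.dom.carrier (𝟙 c') →
      rst M f T = rst M f T') : T = T' := by
  obtain ⟨S, hS, hc⟩ := hM.cover P
  refine eq_of_locally_eq hM.isSheaf hS fun f hf => ?_
  obtain ⟨κ, hκ⟩ := hc f hf
  exact h f κ hκ

theorem nbr₂_of_charts (hM : IsFormalManifold J R M n) {c : C} (P : M.obj (op c)) {m : ℕ}
    {x : Fin m → M.obj (op c)}
    (h : ∀ {c' : C} (f : c' ⟶ c) (κ : Chart J R M n c'), rst M f P ∈ κ.dom.carrier (𝟙 c') →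
      Nbr₂ J R M n fun i => rst M f (x i)) : Nbr₂ J R M n x := by
  obtain ⟨S, hS, hc⟩ := hM.cover P
  refine (secondOrder hM).isLocal x S hS fun f hf => ?_
  obtain ⟨κ, hκ⟩ := hc f hf
  exact h f κ hκ

theorem nbr₂_pair_iff (hR : IsKockLawvere J R) {c : C} (κ : Chart J R M n c) {P : M.obj (op c)}
    (hP : P ∈ κ.dom.carrier (𝟙 c)) (Q : M.obj (op c)) :
    Nbr₂ J R M n ![P, Q] ↔ Q ∈ κ.dom.carrier (𝟙 c) ∧
      ∃ I : Ideal (Scal R c), I * I * I = ⊥ ∧ VecMem I (κ.coord (𝟙 c) Q - κ.coord (𝟙 c) P) := by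
  rw [nbr₂_cons_iff hR κ hP]
  simp

theorem nbr₂_triple_iff (hR : IsKockLawvere J R) {c : C} (κ : Chart J R M n c) {P : M.obj (op c)}
    (hP : P ∈ κ.dom.carrier (𝟙 c)) (Q S : M.obj (op c)) :
    Nbr₂ J R M n ![P, Q, S] ↔ (Q ∈ κ.dom.carrier (𝟙 c) ∧ S ∈ κ.dom.carrier (𝟙 c)) ∧
      ∃ I : Ideal (Scal R c), I * I * I = ⊥ ∧ VecMem I (κ.coord (𝟙 c) Q - κ.coord (𝟙 c) P) ∧
        VecMem I (κ.coord (𝟙 c) S - κ.coord (𝟙 c) P) := by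
  rw [nbr₂_cons_iff hR κ hP]
  simp [Fin.forall_fin_two]

namespace AffineConnection

variable (lam : AffineConnection J R M n)

/-! ### The product of second-order neighbours -/

/-- `T` is the product of `Q` and `S` in the chart `κ` with symbol `Γ` at `P`. -/
def IsProdIn {c : C} (κ : Chart J R M n c) (Γ : Fin n → Fin n → Fin n → Scal R c)
    (P Q S T : M.obj (.op c)) : Prop :=
  T ∈ κ.dom.carrier (𝟙 c) ∧ κ.coord (𝟙 c) T =
    κ.coord (𝟙 c) Q + κ.coord (𝟙 c) S - κ.coord (𝟙 c) P +
      bil Γ (κ.coord (𝟙 c) Q - κ.coord (𝟙 c) P) (κ.coord (𝟙 c) S - κ.coord (𝟙 c) P)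

/-- `T` is the product of `Q` and `S` in the monad of `P`. -/
structure IsProd {c : C} (P Q S T : M.obj (.op c)) : Prop where
  inChart : ∀ {c' : C} (f : c' ⟶ c) (κ : Chart J R M n c') (Γ : Fin n → Fin n → Fin n → Scal R c'),
    rst M f P ∈ κ.dom.carrier (𝟙 c') → lam.IsSymbol κ (rst M f P) Γ →
    IsProdIn κ Γ (rst M f P) (rst M f Q) (rst M f S) (rst M f T)

variable {lam}

theorem IsProdIn.pull {c c' : C} {κ : Chart J R M n c} {Γ : Fin n → Fin n → Fin n → Scal R c}
    {P Q S T : M.obj (.op c)} (h : IsProdIn κ Γ P Q S T) (hP : P ∈ κ.dom.carrier (𝟙 c))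
    (hQ : Q ∈ κ.dom.carrier (𝟙 c)) (hS : S ∈ κ.dom.carrier (𝟙 c)) (f : c' ⟶ c) :
    IsProdIn (κ.pull f) (cres R f Γ) (rst M f P) (rst M f Q) (rst M f S) (rst M f T) := by
  have := congrArg (vres R f) h.2
  simp only [vres_add, vres_sub, vres_bil, ← κ.coord_rst h.1, ← κ.coord_rst hP, ← κ.coord_rst hQ,
    ← κ.coord_rst hS] at this
  refine ⟨by simpa using κ.rst_mem h.1 f, ?_⟩
  simpa only [Chart.pull_coord, Category.id_comp] using this

theorem IsProdIn.eq {c : C} {κ : Chart J R M n c} {Γ : Fin n → Fin n → Fin n → Scal R c}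
    {P Q S T T' : M.obj (.op c)} (h : IsProdIn κ Γ P Q S T) (h' : IsProdIn κ Γ P Q S T') : T = T' :=
  κ.coord_injOn (𝟙 c) h.1 h'.1 (h.2.trans h'.2.symm)

theorem IsProdIn.sub {c : C} {κ : Chart J R M n c} {Γ : Fin n → Fin n → Fin n → Scal R c}
    {P Q S T : M.obj (.op c)} (h : IsProdIn κ Γ P Q S T) :
    κ.coord (𝟙 c) T - κ.coord (𝟙 c) P = (κ.coord (𝟙 c) Q - κ.coord (𝟙 c) P) +
      (κ.coord (𝟙 c) S - κ.coord (𝟙 c) P) +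
      bil Γ (κ.coord (𝟙 c) Q - κ.coord (𝟙 c) P) (κ.coord (𝟙 c) S - κ.coord (𝟙 c) P) := by
  rw [h.2]
  abel

theorem isProdIn_of_sub {c : C} {κ : Chart J R M n c} {Γ : Fin n → Fin n → Fin n → Scal R c}
    {P Q S T : M.obj (.op c)} (hT : T ∈ κ.dom.carrier (𝟙 c))
    (h : κ.coord (𝟙 c) T - κ.coord (𝟙 c) P = (κ.coord (𝟙 c) Q - κ.coord (𝟙 c) P) +
      (κ.coord (𝟙 c) S - κ.coord (𝟙 c) P) +
      bil Γ (κ.coord (𝟙 c) Q - κ.coord (𝟙 c) P) (κ.coord (𝟙 c) S - κ.coord (𝟙 c) P)) :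
    IsProdIn κ Γ P Q S T := by
  refine ⟨hT, ?_⟩
  rw [sub_eq_iff_eq_add.1 h]
  abel

/-- The required coordinates `q + s + Γ[q, s]` lie in the common ideal of `q` and `s`, hence in
`D₂(n)`, so they are realised by a point of the chart. -/
theorem exists_isProdIn (hR : IsKockLawvere J R) {c : C} (κ : Chart J R M n c)
    (Γ : Fin n → Fin n → Fin n → Scal R c) {P Q S : M.obj (.op c)} (hP : P ∈ κ.dom.carrier (𝟙 c))
    (h : Nbr₂ J R M n ![P, Q, S]) : ∃ T, IsProdIn κ Γ P Q S T := by
  obtain ⟨-, I, hI, hq, hs⟩ := (nbr₂_triple_iff hR κ hP Q S).1 h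
  obtain ⟨T, hT, hTc⟩ := κ.exists_coord_eq hP (𝟙 c)
    (((hq.add hs).add ((hq.bil Γ hs).mono Ideal.mul_le_right)).inD₂ hI)
  exact ⟨T, isProdIn_of_sub hT (by rw [hTc, vres_id, add_sub_cancel_left])⟩

/-- The product does not depend on the chart. -/
theorem IsProdIn.change (hR : IsKockLawvere J R) {c : C} {κ κ' : Chart J R M n c}
    {P Q S T : M.obj (.op c)} (hP : P ∈ κ.dom.carrier (𝟙 c)) (hP' : P ∈ κ'.dom.carrier (𝟙 c))
    {Γ Γ' : Fin n → Fin n → Fin n → Scal R c} (hΓ : lam.IsSymbol κ P Γ) (hΓ' : lam.IsSymbol κ' P Γ')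
    (h : Nbr₂ J R M n ![P, Q, S]) (hT : IsProdIn κ Γ P Q S T) : IsProdIn κ' Γ' P Q S T := by
  obtain ⟨⟨hQm, hSm⟩, I, hI, hq, hs⟩ := (nbr₂_triple_iff hR κ hP Q S).1 h
  obtain ⟨A, H, ht⟩ := exists_transition hR κ κ' hP hP'
  have htr := change_of_coordinates hI A H Γ Γ' (hΓ.transform hR hP hP' hΓ' ht) hq hs
  have coords : ∀ Q ∈ κ.dom.carrier (𝟙 c), VecMem I (κ.coord (𝟙 c) Q - κ.coord (𝟙 c) P) →
      Q ∈ κ'.dom.carrier (𝟙 c) ∧ κ'.coord (𝟙 c) Q - κ'.coord (𝟙 c) P =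
        A.mulVec (κ.coord (𝟙 c) Q - κ.coord (𝟙 c) P) +
          bil H (κ.coord (𝟙 c) Q - κ.coord (𝟙 c) P) (κ.coord (𝟙 c) Q - κ.coord (𝟙 c) P) := by
    intro Q hQ hq
    obtain ⟨h1, h2⟩ := ht (𝟙 c) _ (hq.inD₂ hI) Q hQ (by simp)
    rw [vres_id, mres_id, cres_id] at h2
    exact ⟨h1, sub_eq_iff_eq_add'.2 h2⟩
  have ht' : VecMem I (κ.coord (𝟙 c) T - κ.coord (𝟙 c) P) := by
    rw [hT.sub]
    exact (hq.add hs).add ((hq.bil Γ hs).mono Ideal.mul_le_right)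
  obtain ⟨hTm, hTc⟩ := coords T hT.1 ht'
  refine isProdIn_of_sub hTm ?_
  rw [hTc, (coords Q hQm hq).2, (coords S hSm hs).2, hT.sub, htr]

/-- One chart decides for all charts at all later stages: restrict it and compare symbols there. -/
theorem IsProdIn.isProd (hR : IsKockLawvere J R) (hM : IsFormalManifold J R M n) {c : C}
    {κ : Chart J R M n c} {P Q S T : M.obj (.op c)} (hP : P ∈ κ.dom.carrier (𝟙 c))
    {Γ : Fin n → Fin n → Fin n → Scal R c} (hΓ : lam.IsSymbol κ P Γ)
    (h : Nbr₂ J R M n ![P, Q, S]) (hT : IsProdIn κ Γ P Q S T) : lam.IsProd P Q S T := by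
  refine ⟨fun {c'} f κ' Γ' hP' hΓ' => ?_⟩
  have hm := ((nbr₂_triple_iff hR κ hP Q S).1 h).1
  have hr := nbr₂_restrict hM f h
  rw [map_triple (rst M f)] at hr
  exact (hT.pull hP hm.1 hm.2 f).change hR (by simpa using κ.rst_mem hP f) hP' (hΓ.pull f) hΓ' hr

theorem IsProd.isProdIn {c : C} {P Q S T : M.obj (.op c)} (h : lam.IsProd P Q S T)
    {κ : Chart J R M n c} (hP : P ∈ κ.dom.carrier (𝟙 c)) {Γ : Fin n → Fin n → Fin n → Scal R c}
    (hΓ : lam.IsSymbol κ P Γ) : IsProdIn κ Γ P Q S T := by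
  have := h.inChart (𝟙 c) κ Γ
  simp only [rst_id] at this
  exact this hP hΓ

theorem IsProd.restrict {c c' : C} {P Q S T : M.obj (.op c)} (h : lam.IsProd P Q S T) (f : c' ⟶ c) :
    lam.IsProd (rst M f P) (rst M f Q) (rst M f S) (rst M f T) := by
  refine ⟨fun {c''} g κ Γ => ?_⟩
  simp only [rst_rst]
  exact h.inChart (g ≫ f) κ Γ

theorem IsProd.unique (hR : IsKockLawvere J R) (hM : IsFormalManifold J R M n) {c : C}
    {P Q S T T' : M.obj (.op c)} (h : lam.IsProd P Q S T) (h' : lam.IsProd P Q S T') : T = T' := by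
  refine eq_of_charts hM P fun f κ hP => ?_
  obtain ⟨Γ, hΓ⟩ := lam.exists_symbol hR κ hP
  exact (h.inChart f κ Γ hP hΓ).eq (h'.inChart f κ Γ hP hΓ)

theorem IsProd.congr {c : C} {P P' Q Q' S S' T : M.obj (.op c)} (h : lam.IsProd P Q S T)
    (eP : P = P') (eQ : Q = Q') (eS : S = S') : lam.IsProd P' Q' S' T := by
  subst eP eQ eS
  exact h

/-- In a given chart the neighbour hypothesis supplies a product; it agrees locally with the
restriction of `T`, hence equals it. -/
theorem isProd_of_local (hR : IsKockLawvere J R) (hM : IsFormalManifold J R M n) {c : C}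
    {P Q S T : M.obj (.op c)} (h : Nbr₂ J R M n ![P, Q, S]) {V : Sieve c} (hV : V ∈ J c)
    (hT : ∀ {c' : C} (f : c' ⟶ c), V f →
      lam.IsProd (rst M f P) (rst M f Q) (rst M f S) (rst M f T)) : lam.IsProd P Q S T := by
  refine ⟨fun {c'} f κ Γ hP hΓ => ?_⟩
  have hr := nbr₂_restrict hM f h
  rw [map_triple (rst M f)] at hr
  obtain ⟨T', hT'⟩ := exists_isProdIn hR κ Γ hP hr
  have e : T' = rst M f T := by
    refine eq_of_locally_eq hM.isSheaf (J.pullback_stable f hV) fun g hg => ?_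
    have h1 := (hT'.isProd hR hM hP hΓ hr).restrict g
    have h2 := hT (g ≫ f) hg
    simp only [rst_rst] at h1 ⊢
    exact h1.unique hR hM h2
  rwa [← e]

variable (lam) in
theorem exists_isProd (hR : IsKockLawvere J R) (hM : IsFormalManifold J R M n) {c : C}
    {P Q S : M.obj (.op c)} (h : Nbr₂ J R M n ![P, Q, S]) : ∃ T, lam.IsProd P Q S T := by
  obtain ⟨V, hV, hc⟩ := hM.cover P
  obtain ⟨T, hT⟩ := exists_glue hM.isSheaf
    (fun f T => lam.IsProd (rst M f P) (rst M f Q) (rst M f S) T)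
    (fun f g T hT => by
      have := hT.restrict g
      simp only [rst_rst] at this
      exact this)
    (fun f T T' hT hT' => hT.unique hR hM hT') hV (fun f hf => by
      obtain ⟨κ, hκ⟩ := hc f hf
      obtain ⟨Γ, hΓ⟩ := lam.exists_symbol hR κ hκ
      have hr := nbr₂_restrict hM f h
      rw [map_triple (rst M f)] at hr
      obtain ⟨T, hT⟩ := exists_isProdIn hR κ Γ hκ hr
      exact ⟨T, hT.isProd hR hM hκ hΓ hr⟩)
  exact ⟨T, isProd_of_local hR hM h hV hT⟩

/-- The ideal witnessing the hypothesis also contains the coordinates of the product. -/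
theorem IsProd.nbr₂ (hR : IsKockLawvere J R) (hM : IsFormalManifold J R M n) {c : C}
    {P Q S T : M.obj (.op c)} (hT : lam.IsProd P Q S T) {m : ℕ} {x : Fin m → M.obj (.op c)}
    (h : Nbr₂ J R M n (Matrix.vecCons P (Matrix.vecCons Q (Matrix.vecCons S x)))) :
    Nbr₂ J R M n (Matrix.vecCons P (Matrix.vecCons T x)) := by
  refine nbr₂_of_charts hM P fun f κ hP => ?_
  obtain ⟨Γ, hΓ⟩ := lam.exists_symbol hR κ hP
  have hr := nbr₂_restrict hM f h
  simp only [map_vecCons (rst M f)] at hr ⊢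
  rw [nbr₂_cons_iff hR κ hP] at hr ⊢
  obtain ⟨hm, I, hI, hx⟩ := hr
  have hTf := hT.inChart f κ Γ hP hΓ
  refine ⟨Fin.cases hTf.1 fun i => hm i.succ.succ, I, hI, Fin.cases ?_ fun i => hx i.succ.succ⟩
  rw [Matrix.cons_val_zero, hTf.sub]
  exact ((hx 0).add (hx 1)).add (((hx 0).bil Γ (hx 1)).mono Ideal.mul_le_right)

theorem IsProd.assoc (hR : IsKockLawvere J R) (hM : IsFormalManifold J R M n) {c : C}
    {P A B D U V W Z : M.obj (.op c)} (h : Nbr₂ J R M n ![P, A, B, D]) (hU : lam.IsProd P A B U)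
    (hV : lam.IsProd P U D V) (hW : lam.IsProd P B D W) (hZ : lam.IsProd P A W Z) : V = Z := by
  refine eq_of_charts hM P fun f κ hP => ?_
  obtain ⟨Γ, hΓ⟩ := lam.exists_symbol hR κ hP
  have hr := nbr₂_restrict hM f h
  rw [map_vecCons (rst M f), map_triple (rst M f), nbr₂_cons_iff hR κ hP] at hr
  obtain ⟨-, I, hI, hx⟩ := hr
  have hV' := hV.inChart f κ Γ hP hΓ
  have hZ' := hZ.inChart f κ Γ hP hΓ
  refine κ.coord_injOn (𝟙 _) hV'.1 hZ'.1 (sub_left_injective (b := κ.coord (𝟙 _) (rst M f P)) ?_)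
  simp only [hV'.sub, hZ'.sub, (hU.inChart f κ Γ hP hΓ).sub, (hW.inChart f κ Γ hP hΓ).sub]
  exact assoc_of_cube_zero hI Γ (hx 0) (hx 1) (hx 2)

theorem IsProd.base_left (hR : IsKockLawvere J R) (hM : IsFormalManifold J R M n) {c : C}
    {P Q T : M.obj (.op c)} (h : Nbr₂ J R M n ![P, Q]) (hT : lam.IsProd P P Q T) : T = Q := by
  refine eq_of_charts hM P fun f κ hP => ?_
  obtain ⟨Γ, hΓ⟩ := lam.exists_symbol hR κ hP
  have hr := nbr₂_restrict hM f h
  rw [map_pair (rst M f), nbr₂_pair_iff hR κ hP] at hr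
  have hT' := hT.inChart f κ Γ hP hΓ
  refine κ.coord_injOn (𝟙 _) hT'.1 hr.1 ?_
  rw [hT'.2, sub_self, bil_zero_left]
  abel

theorem IsProd.base_right (hR : IsKockLawvere J R) (hM : IsFormalManifold J R M n) {c : C}
    {P Q T : M.obj (.op c)} (h : Nbr₂ J R M n ![P, Q]) (hT : lam.IsProd P Q P T) : T = Q := by
  refine eq_of_charts hM P fun f κ hP => ?_
  obtain ⟨Γ, hΓ⟩ := lam.exists_symbol hR κ hP
  have hr := nbr₂_restrict hM f h
  rw [map_pair (rst M f), nbr₂_pair_iff hR κ hP] at hr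
  have hT' := hT.inChart f κ Γ hP hΓ
  refine κ.coord_injOn (𝟙 _) hT'.1 hr.1 ?_
  rw [hT'.2, sub_self, bil_zero_right]
  abel

/-- `Q` and `S` need not be neighbours of each other; two square-zero ideals have a sum of cube
zero. -/
theorem nbr₂_of_nbr₁ (hR : IsKockLawvere J R) (hM : IsFormalManifold J R M n) {c : C}
    {P Q S : M.obj (.op c)} (hQ : Nbr₁ J R M n P Q) (hS : Nbr₁ J R M n P S) :
    Nbr₂ J R M n ![P, Q, S] := by
  refine nbr₂_of_charts hM P fun f κ hP => ?_
  rw [map_triple (rst M f), nbr₂_triple_iff hR κ hP]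
  obtain ⟨hQm, hQd⟩ := (hQ.restrict f).mem_coord hR κ hP
  obtain ⟨hSm, hSd⟩ := (hS.restrict f).mem_coord hR κ hP
  exact ⟨⟨hQm, hSm⟩, hQd.exists_cube_zero hSd⟩

variable (lam) in
-- The defining formula of the symbol is the product formula restricted to first-order neighbours,
-- so the product extends `λ`.
theorem isProd_op {c : C} {P Q S : M.obj (.op c)} (hQ : Nbr₁ J R M n P Q)
    (hS : Nbr₁ J R M n P S) : lam.IsProd P Q S (lam.op P Q S hQ hS) := by
  refine ⟨fun {c'} f κ Γ hP hΓ => ?_⟩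
  rw [lam.natural f P Q S hQ hS (hQ.restrict f) (hS.restrict f)]
  have := hΓ (𝟙 c') (rst M f Q) (rst M f S)
  simp only [rst_id, cres_id] at this
  exact (this (hQ.restrict f) (hS.restrict f)).2.2

/-! ### Inverses -/

variable (lam) in
/-- `T` is the inverse of `Q` in the monad of `P`. -/
def IsInv {c : C} (P Q T : M.obj (.op c)) : Prop :=
  Nbr₂ J R M n ![P, Q, T] ∧ lam.IsProd P Q T P

theorem IsInv.restrict (hM : IsFormalManifold J R M n) {c c' : C} {P Q T : M.obj (.op c)}
    (h : lam.IsInv P Q T) (f : c' ⟶ c) : lam.IsInv (rst M f P) (rst M f Q) (rst M f T) := by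
  refine ⟨?_, h.2.restrict f⟩
  have := nbr₂_restrict hM f h.1
  rwa [map_triple (rst M f)] at this

/-- The equation `q + t + Γ[q, t] = 0` has exactly one solution among vectors with coordinates in
the common ideal; this also gives uniqueness of inverses. -/
theorem IsInv.coord (hR : IsKockLawvere J R) {c : C} {P Q T : M.obj (.op c)}
    (h : lam.IsInv P Q T) {κ : Chart J R M n c} (hP : P ∈ κ.dom.carrier (𝟙 c))
    {Γ : Fin n → Fin n → Fin n → Scal R c} (hΓ : lam.IsSymbol κ P Γ) :
    T ∈ κ.dom.carrier (𝟙 c) ∧ κ.coord (𝟙 c) T - κ.coord (𝟙 c) P =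
      -(κ.coord (𝟙 c) Q - κ.coord (𝟙 c) P) +
        bil Γ (κ.coord (𝟙 c) Q - κ.coord (𝟙 c) P) (κ.coord (𝟙 c) Q - κ.coord (𝟙 c) P) := by
  obtain ⟨⟨-, hT⟩, I, hI, hq, ht⟩ := (nbr₂_triple_iff hR κ hP Q T).1 h.1
  refine ⟨hT, (add_add_bil_eq_zero_iff hI Γ hq ht).1 ?_⟩
  rw [← (h.2.isProdIn hP hΓ).sub, sub_self]

theorem exists_isInv_of_chart (hR : IsKockLawvere J R) (hM : IsFormalManifold J R M n) {c : C}
    {P Q : M.obj (.op c)} {κ : Chart J R M n c} (hP : P ∈ κ.dom.carrier (𝟙 c))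
    (h : Nbr₂ J R M n ![P, Q]) : ∃ T, lam.IsInv P Q T := by
  obtain ⟨Γ, hΓ⟩ := lam.exists_symbol hR κ hP
  obtain ⟨hQm, I, hI, hq⟩ := (nbr₂_pair_iff hR κ hP Q).1 h
  have ht := hq.neg.add ((hq.bil Γ hq).mono Ideal.mul_le_right)
  obtain ⟨T, hT, hTc⟩ := κ.exists_coord_eq hP (𝟙 c) (ht.inD₂ hI)
  rw [vres_id, ← sub_eq_iff_eq_add'] at hTc
  have hn : Nbr₂ J R M n ![P, Q, T] :=
    (nbr₂_triple_iff hR κ hP Q T).2 ⟨⟨hQm, hT⟩, I, hI, hq, by rwa [hTc]⟩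
  refine ⟨T, hn, IsProdIn.isProd hR hM hP hΓ hn (isProdIn_of_sub hP ?_)⟩
  rw [sub_self, hTc]
  exact ((add_add_bil_eq_zero_iff hI Γ hq ht).2 rfl).symm

theorem IsInv.unique (hR : IsKockLawvere J R) (hM : IsFormalManifold J R M n) {c : C}
    {P Q T T' : M.obj (.op c)} (h : lam.IsInv P Q T) (h' : lam.IsInv P Q T') : T = T' := by
  refine eq_of_charts hM P fun f κ hP => ?_
  obtain ⟨Γ, hΓ⟩ := lam.exists_symbol hR κ hP
  have h1 := (h.restrict hM f).coord hR hP hΓ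
  have h2 := (h'.restrict hM f).coord hR hP hΓ
  exact κ.coord_injOn (𝟙 _) h1.1 h2.1 (sub_left_injective (h1.2.trans h2.2.symm))

variable (lam) in
theorem exists_isInv (hR : IsKockLawvere J R) (hM : IsFormalManifold J R M n) {c : C}
    {P Q : M.obj (.op c)} (h : Nbr₂ J R M n ![P, Q]) : ∃ T, lam.IsInv P Q T := by
  obtain ⟨V, hV, hc⟩ := hM.cover P
  obtain ⟨T, hT⟩ := exists_glue hM.isSheaf
    (fun f T => lam.IsInv (rst M f P) (rst M f Q) T)
    (fun f g T hT => by
      have := hT.restrict hM g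
      simp only [rst_rst] at this
      exact this)
    (fun f T T' hT hT' => hT.unique hR hM hT') hV (fun f hf => by
      obtain ⟨κ, hκ⟩ := hc f hf
      have hr := nbr₂_restrict hM f h
      rw [map_pair (rst M f)] at hr
      exact exists_isInv_of_chart hR hM hκ hr)
  -- Both clauses of being an inverse have to descend from the cover; neighbourhood does so by
  -- locality of the i-structure.
  have hn : Nbr₂ J R M n ![P, Q, T] := (secondOrder hM).isLocal _ V hV fun f hf => by
    rw [map_triple (rst M f)]
    exact (hT f hf).1
  exact ⟨T, hn, isProd_of_local hR hM hn hV fun f hf => (hT f hf).2⟩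

theorem IsInv.nbr₂ (hR : IsKockLawvere J R) (hM : IsFormalManifold J R M n) {c : C}
    {P Q T : M.obj (.op c)} (hT : lam.IsInv P Q T) {m : ℕ} {x : Fin m → M.obj (.op c)}
    (h : Nbr₂ J R M n (Matrix.vecCons P (Matrix.vecCons Q x))) :
    Nbr₂ J R M n (Matrix.vecCons P (Matrix.vecCons T x)) := by
  refine nbr₂_of_charts hM P fun f κ hP => ?_
  obtain ⟨Γ, hΓ⟩ := lam.exists_symbol hR κ hP
  have hr := nbr₂_restrict hM f h
  simp only [map_vecCons (rst M f)] at hr ⊢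
  rw [nbr₂_cons_iff hR κ hP] at hr ⊢
  obtain ⟨hm, I, hI, hx⟩ := hr
  have hTf := (hT.restrict hM f).coord hR hP hΓ
  refine ⟨Fin.cases hTf.1 fun i => hm i.succ, I, hI, Fin.cases ?_ fun i => hx i.succ⟩
  rw [Matrix.cons_val_zero, hTf.2]
  exact (hx 0).neg.add (((hx 0).bil Γ (hx 0)).mono Ideal.mul_le_right)

theorem IsInv.isProd_symm (hR : IsKockLawvere J R) (hM : IsFormalManifold J R M n) {c : C}
    {P Q T U : M.obj (.op c)} (hT : lam.IsInv P Q T) (hU : lam.IsProd P T Q U) : U = P := by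
  refine eq_of_charts hM P fun f κ hP => ?_
  obtain ⟨Γ, hΓ⟩ := lam.exists_symbol hR κ hP
  have hTf := hT.restrict hM f
  obtain ⟨-, I, hI, hq, -⟩ := (nbr₂_triple_iff hR κ hP _ _).1 hTf.1
  have hU' := hU.inChart f κ Γ hP hΓ
  refine κ.coord_injOn (𝟙 _) hU'.1 hP (sub_eq_zero.1 ?_)
  rw [hU'.sub, (hTf.coord hR hP hΓ).2]
  exact inv_comm_of_cube_zero hI Γ hq

end AffineConnection

end Product

/-! ### The infinitesimal group structure on the second-order monads -/

section Group

variable {J : GrothendieckTopology C} {R : Cᵒᵖ ⥤ CommAlgCat.{w} ℚ} {M : Cᵒᵖ ⥤ Type w} {n : ℕ}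

theorem monad_nbr_cons (hM : IsFormalManifold J R M n) {c : C} {P : M.obj (op c)} {X : Over c} {m : ℕ}
    (Q : (monad (secondOrder hM) P).obj (op X)) (x : Fin m → (monad (secondOrder hM) P).obj (op X)) :
    (monadIStructure (secondOrder hM) P).nbr (Matrix.vecCons Q x) ↔
      Nbr₂ J R M n (Matrix.vecCons (rst M X.hom P) (Matrix.vecCons Q.1 fun i => (x i).1)) := by
  rw [← map_vecCons (fun Q : (monad (secondOrder hM) P).obj (op X) => Q.1) Q x]
  rfl

theorem monad_nbr_pair (hM : IsFormalManifold J R M n) {c : C} {P : M.obj (op c)} {X : Over c}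
    (Q S : (monad (secondOrder hM) P).obj (op X)) :
    (monadIStructure (secondOrder hM) P).nbr ![Q, S] ↔
      Nbr₂ J R M n ![rst M X.hom P, Q.1, S.1] := by
  rw [← map_pair (fun Q : (monad (secondOrder hM) P).obj (op X) => Q.1) Q S]
  rfl

theorem monad_nbr_triple (hM : IsFormalManifold J R M n) {c : C} {P : M.obj (op c)} {X : Over c}
    (Q S T : (monad (secondOrder hM) P).obj (op X)) :
    (monadIStructure (secondOrder hM) P).nbr ![Q, S, T] ↔
      Nbr₂ J R M n ![rst M X.hom P, Q.1, S.1, T.1] := by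
  rw [← map_triple (fun Q : (monad (secondOrder hM) P).obj (op X) => Q.1) Q S T]
  rfl

/-- Reindexing along the map that hits the index `0` twice. -/
theorem nbr₂_cons_base (hM : IsFormalManifold J R M n) {c : C} {P : M.obj (op c)} {m : ℕ}
    {x : Fin m → M.obj (op c)} (h : Nbr₂ J R M n (Matrix.vecCons P x)) :
    Nbr₂ J R M n (Matrix.vecCons P (Matrix.vecCons P x)) := by
  have := nbr₂_reindex hM (Fin.cases 0 id : Fin (m + 1 + 1) → Fin (m + 1)) h
  convert this using 1
  funext i
  refine Fin.cases ?_ (fun i => ?_) i <;> simp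

theorem AffineConnection.IsProd.nbr₂_pair {lam : AffineConnection J R M n} (hR : IsKockLawvere J R)
    (hM : IsFormalManifold J R M n) {c : C} {P Q S T : M.obj (.op c)} (hT : lam.IsProd P Q S T)
    (h : Nbr₂ J R M n ![P, Q, S]) : Nbr₂ J R M n ![P, T] :=
  hT.nbr₂ hR hM (x := ![]) h

theorem AffineConnection.IsInv.nbr₂_pair {lam : AffineConnection J R M n} (hR : IsKockLawvere J R)
    (hM : IsFormalManifold J R M n) {c : C} {P Q T : M.obj (.op c)} (hT : lam.IsInv P Q T)
    (h : Nbr₂ J R M n ![P, Q]) : Nbr₂ J R M n ![P, T] :=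
  hT.nbr₂ hR hM (x := ![]) h

variable (lam : AffineConnection J R M n) (hR : IsKockLawvere J R)
  (hM : IsFormalManifold J R M n)

/-- The product in the second-order monad. -/
noncomputable def monadMul {c : C} (P : M.obj (op c)) {X : Over c}
    (Q S : (monad (secondOrder hM) P).obj (op X))
    (h : (monadIStructure (secondOrder hM) P).nbr ![Q, S]) :
    (monad (secondOrder hM) P).obj (op X) :=
  ⟨(lam.exists_isProd hR hM ((monad_nbr_pair hM Q S).1 h)).choose,
    (lam.exists_isProd hR hM ((monad_nbr_pair hM Q S).1 h)).choose_spec.nbr₂_pair hR hM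
      ((monad_nbr_pair hM Q S).1 h)⟩

theorem isProd_monadMul {c : C} (P : M.obj (op c)) {X : Over c}
    (Q S : (monad (secondOrder hM) P).obj (op X))
    (h : (monadIStructure (secondOrder hM) P).nbr ![Q, S]) :
    lam.IsProd (rst M X.hom P) Q.1 S.1 (monadMul lam hR hM P Q S h).1 :=
  (lam.exists_isProd hR hM ((monad_nbr_pair hM Q S).1 h)).choose_spec

/-- The inverse in the second-order monad. -/
noncomputable def monadInv {c : C} (P : M.obj (op c)) {X : Over c}
    (Q : (monad (secondOrder hM) P).obj (op X)) : (monad (secondOrder hM) P).obj (op X) :=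
  ⟨(lam.exists_isInv hR hM Q.2).choose,
    (lam.exists_isInv hR hM Q.2).choose_spec.nbr₂_pair hR hM Q.2⟩

theorem isInv_monadInv {c : C} (P : M.obj (op c)) {X : Over c}
    (Q : (monad (secondOrder hM) P).obj (op X)) :
    lam.IsInv (rst M X.hom P) Q.1 (monadInv lam hR hM P Q).1 :=
  (lam.exists_isInv hR hM Q.2).choose_spec

/-- The neutral element of the second-order monad. -/
def monadOne {c : C} (P : M.obj (op c)) (X : Over c) : (monad (secondOrder hM) P).obj (op X) :=
  ⟨rst M X.hom P, nbr₂_cons_base hM (x := ![]) (show Nbr₂ J R M n ![rst M X.hom P] from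
    (secondOrder hM).nbr_one _)⟩

/-- The infinitesimal group structure on the second-order monad of `P`. -/
noncomputable def monadGroup {c : C} (P : M.obj (op c)) : MonadGroup hM P where
  mul Q S h := monadMul lam hR hM P Q S h
  inv Q := monadInv lam hR hM P Q
  e X := monadOne hM P X
  mul_natural {X Y} f Q S h h' := by
    refine Subtype.ext ?_
    -- Products are obtained by choice at each stage; uniqueness makes them natural.
    have h1 := (isProd_monadMul lam hR hM P Q S h).restrict f.left
    rw [rst_rst, Over.w] at h1
    exact h1.unique hR hM (isProd_monadMul lam hR hM P _ _ h')
  inv_natural {X Y} f Q := by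
    refine Subtype.ext ?_
    have h1 := (isInv_monadInv lam hR hM P Q).restrict hM f.left
    rw [rst_rst, Over.w] at h1
    exact h1.unique hR hM (isInv_monadInv lam hR hM P (rst (monad (secondOrder hM) P) f Q))
  e_natural {X Y} f := by
    refine Subtype.ext ((rst_rst X.hom f.left P).trans ?_)
    rw [Over.w]
    rfl
  nbr_mul {X m} Q S x h hx := by
    rw [monad_nbr_cons, map_vecCons (fun Q : (monad (secondOrder hM) P).obj (op X) => Q.1)] at hx
    rw [monad_nbr_cons]
    exact (isProd_monadMul lam hR hM P Q S h).nbr₂ hR hM hx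
  nbr_inv {X m} Q x hx := by
    rw [monad_nbr_cons] at hx ⊢
    exact (isInv_monadInv lam hR hM P Q).nbr₂ hR hM hx
  nbr_e {X m} x hx := by
    rw [monad_nbr_cons]
    exact nbr₂_cons_base hM hx
  assoc {X} Q S T h hQS hST h1 h2 := Subtype.ext <|
    AffineConnection.IsProd.assoc hR hM ((monad_nbr_triple hM Q S T).1 h)
      (isProd_monadMul lam hR hM P Q S hQS) (isProd_monadMul lam hR hM P _ T h1)
      (isProd_monadMul lam hR hM P S T hST) (isProd_monadMul lam hR hM P Q _ h2)
  e_mul {X} Q h := Subtype.ext <| (isProd_monadMul lam hR hM P _ Q h).base_left hR hM Q.2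
  mul_e {X} Q h := Subtype.ext <| (isProd_monadMul lam hR hM P Q _ h).base_right hR hM Q.2
  mul_inv {X} Q h := Subtype.ext <| (isProd_monadMul lam hR hM P Q _ h).unique hR hM
    (isInv_monadInv lam hR hM P Q).2
  inv_mul {X} Q h := Subtype.ext <| (isInv_monadInv lam hR hM P Q).isProd_symm hR hM
    (isProd_monadMul lam hR hM P _ Q h)

end Group

end SDG

/-! ### The theorem -/

open SDG in
theorem mainTheorem1 {C : Type u} [Category.{v} C] (J : GrothendieckTopology C)
    (R : Cᵒᵖ ⥤ CommAlgCat.{w} ℚ) (hR : IsKockLawvere J R)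
    (n : ℕ) (M : Cᵒᵖ ⥤ Type w) (hM : IsFormalManifold J R M n)
    (lam : AffineConnection J R M n) :
    ∃ G : ∀ {c : C} (P : M.obj (op c)), MonadGroup hM P,
      -- the structure on `𝔐₂(P)` depends naturally on `P`
      (∀ {c c' : C} (f : c' ⟶ c) (P : M.obj (op c)) (X : Over c')
        (Q S : (monad (secondOrder hM) (rst M f P)).obj (op X))
        (Q' S' : (monad (secondOrder hM) P).obj (op ((Over.map f).obj X)))
        (h : (monadIStructure (secondOrder hM) (rst M f P)).nbr ![Q, S])
        (h' : (monadIStructure (secondOrder hM) P).nbr ![Q', S']),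
        Q.1 = Q'.1 → S.1 = S'.1 →
          ((G (rst M f P)).mul Q S h).1 = ((G P).mul Q' S' h').1) ∧
      -- `QS = λ(P, Q, S)` for all `Q, S ∈ 𝔐(P)`
      (∀ {c : C} (P : M.obj (op c)) (X : Over c) (Q S : M.obj (op X.left))
        (hQ : Nbr₁ J R M n (rst M X.hom P) Q) (hS : Nbr₁ J R M n (rst M X.hom P) S),
        ∃ (hQ' : (secondOrder hM).nbr ![rst M X.hom P, Q])
          (hS' : (secondOrder hM).nbr ![rst M X.hom P, S])
          (h : (monadIStructure (secondOrder hM) P).nbr (c := X) ![⟨Q, hQ'⟩, ⟨S, hS'⟩]),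
          lam.op (rst M X.hom P) Q S hQ hS = ((G P).mul (c := X) ⟨Q, hQ'⟩ ⟨S, hS'⟩ h).1) ∧
      -- `P` is the neutral element of `𝔐₂(P)`
      (∀ {c : C} (P : M.obj (op c)) (X : Over c), ((G P).e X).1 = rst M X.hom P) ∧
      -- the structure is transported along `log` and `exp` from the second-order BCH law
      -- `(s, t) ↦ s + t + ½ [s, t]`, `t ↦ -t` of the tangent space at `P`
      (∀ {c : C} (P : M.obj (op c)) (κ : Chart J R M n c), P ∈ κ.dom.carrier (𝟙 c) →
        ∃ Γ B : Fin n → Fin n → Fin n → Scal R c,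
          lam.IsSymbol κ P Γ ∧ lam.IsTorsionBracket κ P B ∧
          ∀ (X : Over c), ∀ p, p = κ.coord X.hom (rst M X.hom P) →
            ∀ Γ', Γ' = symmCoeff (cres R X.hom Γ) →
            (∀ (Q S : (monad (secondOrder hM) P).obj (op X))
              (h : (monadIStructure (secondOrder hM) P).nbr ![Q, S]),
              Q.1 ∈ κ.dom.carrier X.hom ∧ S.1 ∈ κ.dom.carrier X.hom ∧
              ((G P).mul Q S h).1 ∈ κ.dom.carrier X.hom ∧
              κ.coord X.hom ((G P).mul Q S h).1 =
                expAt Γ' p (logAt Γ' p (κ.coord X.hom Q.1) + logAt Γ' p (κ.coord X.hom S.1) +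
                  (1 / 2 : ℚ) • bil (cres R X.hom B)
                    (logAt Γ' p (κ.coord X.hom Q.1)) (logAt Γ' p (κ.coord X.hom S.1)))) ∧
            (∀ Q : (monad (secondOrder hM) P).obj (op X),
              Q.1 ∈ κ.dom.carrier X.hom ∧ ((G P).inv Q).1 ∈ κ.dom.carrier X.hom ∧
              κ.coord X.hom ((G P).inv Q).1 =
                expAt Γ' p (-logAt Γ' p (κ.coord X.hom Q.1)))) := by
  refine ⟨fun P => monadGroup lam hR hM P, ?_, ?_, fun P X => rfl, ?_⟩
  · intro c c' f P X Q S Q' S' h h' hQ hS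
    have h1 := isProd_monadMul lam hR hM (rst M f P) Q S h
    have h2 := isProd_monadMul lam hR hM P Q' S' h'
    -- Both products are taken over the same restricted base point, where products are unique.
    exact (h1.congr (rst_rst f X.hom P) hQ hS).unique hR hM h2
  · intro c P X Q S hQ hS
    have h := AffineConnection.nbr₂_of_nbr₁ hR hM hQ hS
    have hQ' : Nbr₂ J R M n ![rst M X.hom P, Q] := by
      have := nbr₂_reindex hM ![0, 1] h
      convert this using 1
      funext i
      fin_cases i <;> rfl
    have hS' : Nbr₂ J R M n ![rst M X.hom P, S] := by
      have := nbr₂_reindex hM ![0, 2] h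
      convert this using 1
      funext i
      fin_cases i <;> rfl
    have hn := (monad_nbr_pair hM (P := P) (X := X) ⟨Q, hQ'⟩ ⟨S, hS'⟩).2 h
    exact ⟨hQ', hS', hn, (AffineConnection.isProd_op lam hQ hS).unique hR hM
      (isProd_monadMul lam hR hM P _ _ hn)⟩
  · intro c P κ hP
    obtain ⟨Γ, hΓ⟩ := lam.exists_symbol hR κ hP
    -- The bracket is the commutator of the symbol, without a factor `½`; that factor stands in the
    -- group law.
    refine ⟨Γ, fun k i j => Γ k i j - Γ k j i, hΓ, hΓ.isTorsionBracket hR hP, ?_⟩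
    rintro X _ rfl _ rfl
    have hPX : rst M X.hom P ∈ (κ.pull X.hom).dom.carrier (𝟙 X.left) := by
      simpa using κ.rst_mem hP X.hom
    refine ⟨fun Q S h => ?_, fun Q => ?_⟩
    · obtain ⟨⟨hQm, hSm⟩, I, hI, hq, hs⟩ :=
        (nbr₂_triple_iff hR (κ.pull X.hom) hPX Q.1 S.1).1 ((monad_nbr_pair hM Q S).1 h)
      have hT := (isProd_monadMul lam hR hM P Q S h).isProdIn hPX (hΓ.pull X.hom)
      simp only [AffineConnection.IsProdIn, Chart.pull_carrier, Chart.pull_coord,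
        Category.id_comp] at hQm hSm hq hs hT
      refine ⟨hQm, hSm, hT.1, hT.2.trans ?_⟩
      have hB : cres R X.hom (fun k i j => Γ k i j - Γ k j i) =
          fun k i j => cres R X.hom Γ k i j - cres R X.hom Γ k j i := by
        funext k i j
        simp [cres]
      rw [hB]
      exact (expAt_log_add_log hI _ hq hs).symm
    · obtain ⟨hQm, I, hI, hq⟩ := (nbr₂_pair_iff hR (κ.pull X.hom) hPX Q.1).1 Q.2
      have hT := (isInv_monadInv lam hR hM P Q).coord hR hPX (hΓ.pull X.hom)
      simp only [Chart.pull_carrier, Chart.pull_coord, Category.id_comp] at hQm hq hT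
      exact ⟨hQm, hT.1, (sub_eq_iff_eq_add'.1 hT.2).trans (expAt_neg_log hI _ hq).symm⟩
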